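/- Let $e_3<0$, $e_3<e_2<|e_3|/2$ and $e_1=-e_2-e_3$, so that $e_3<e_2<e_1$. Let $w$ be an integrable weight on $[e_3,e_2]$ with $w>0$ almost everywhere, and let $$\widetilde w(x)=\frac{(x-e_3)(e_2-x)}{e_1-x}\,w(x),\qquad x\in[e_3,e_2].$$ Denote by $P_n(\cdot;w)$ and $P_n(\cdot;\widetilde w)$ the monic polynomials of degree $n$ orthogonal on $[e_3,e_2]$ with respect to $w$ and $\widetilde w$, respectively. For functions $F,G$ on a curve $\gamma\subset\mathbb C$, analytic on a neighbourhood of $\gamma$, with zeros $z_1,\dots,z_k$ of $F$ and $w_1,\dots,w_m$ of $G$ in $\gamma$ (listed with multiplicity), write $F\preccurlyeq G$ in $\gamma$ if, in a suitable listing, either $m=k$ and $\Re z_1\le\Re w_1\le\Re z_2\le\dots\le\Re z_k\le\Re w_k$, or $m=k-1$ and $\Re z_1\le\Re w_1\le\dots\le\Re w_{k-1}\le\Re z_k$; write $F\prec G$ in $\gamma$ if all these inequalities are strict. (1) Let $\omega_1>0$ and $\omega_3=i\tau$, $\tau>0$, be half-periods of a rectangular lattice $\Lambda=2\omega_1\mathbb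 Z+2\omega_3\mathbb Z$ whose Weierstrass function $\wp=\wp(\cdot;\Lambda)$ satisfies $\wp(\omega_1)=e_1$, $\wp(\omega_1+\omega_3)=e_2$, $\wp(\omega_3)=e_3$. Define, for $j\ge 0$, $$F_{2j}(z)=P_j(\wp(z);w),\qquad F_{2j+1}(z)=-\frac12\,\frac{\wp'(z)}{\wp(z)-e_1}\,P_j(\wp(z);\widetilde w),$$ and let $\widehat\gamma_2=\{\omega_3+t\omega_1:\ t\in[0,1]\}$ and $\widehat\gamma_2^{\,\circ}=\{\omega_3+t\omega_1:\ t\in(0,1)\}$. Then for every $n\ge 0$ one has $F_{n+2}\prec F_n$ in $\widehat\gamma_2^{\,\circ}$ and $F_{n+2}\preccurlyeq F_n$ in $\widehat\gamma_2$; moreover, if $n$ is even, then $F_{n+2}\prec F_n$ in the closed half contour $\widehat\gamma_2$. (For odd $n$ the functions $F_n$ and $F_{n+2}$ have common zeros at both endpoints of $\widehat\gamma_2$.) (2) For every $n\ge 1$, $P_n(\cdot;w)\prec P_{n-1}(\cdot;\widetilde w)$ in $[e_3,e_2]$. -/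

import Mathlib

open Complex Polynomial MeasureTheory
open scoped PeriodPair

noncomputable section

/-! ### Interlacing of zeros on a curve -/

/-- `z 0, …, z (N - 1)` are the zeros of `F` on `γ`, each repeated according to its multiplicity
(in particular `F` has only finitely many zeros on `γ`, all of finite multiplicity). -/
structure ListsZeros (F : ℂ → ℂ) (γ : Set ℂ) (N : ℕ) (z : ℕ → ℂ) : Prop where
  analytic : AnalyticOnNhd ℂ F γ
  mem : ∀ i, i < N → z i ∈ γ
  mult : ∀ x ∈ γ, analyticOrderAt F x = (((Finset.range N).filter (fun i => z i = x)).card : ℕ∞)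

/-- The zeros `z` of `F` and `w` of `G` on `γ` can be listed so that
`Re z₁ r Re w₁ r Re z₂ r Re w₂ r …`, where `G` has as many zeros as `F` or exactly one fewer. -/
def InterlacesWith (r : ℝ → ℝ → Prop) (F G : ℂ → ℂ) (γ : Set ℂ) : Prop :=
  ∃ (n m : ℕ) (z w : ℕ → ℂ), ListsZeros F γ n z ∧ ListsZeros G γ m w ∧
    (n = m ∨ n = m + 1) ∧
    (∀ i, i < m → r (z i).re (w i).re) ∧
    (∀ i, i + 1 < n → r (w i).re (z (i + 1)).re)

/-- `F ≼ G` in `γ`. -/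
def Interlaces (F G : ℂ → ℂ) (γ : Set ℂ) : Prop := InterlacesWith (fun s t => s ≤ t) F G γ

/-- `F ≺ G` in `γ`. -/
def StrictlyInterlaces (F G : ℂ → ℂ) (γ : Set ℂ) : Prop := InterlacesWith (fun s t => s < t) F G γ

/-! ### Orthogonal polynomials on a real interval -/

/-- An integrable weight on `[a, b]` that is positive almost everywhere. -/
structure IsWeight (w : ℝ → ℝ) (a b : ℝ) : Prop where
  integrable : IntegrableOn w (Set.Icc a b)
  pos : ∀ᵐ x ∂(volume.restrict (Set.Icc a b)), 0 < w x

/-- `P` is a monic polynomial of degree `n`, orthogonal on `[a, b]` with respect to `w` to all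
polynomials of lower degree. -/
structure IsMonicOrthogonal (w : ℝ → ℝ) (a b : ℝ) (n : ℕ) (P : ℝ[X]) : Prop where
  monic : P.Monic
  natDegree_eq : P.natDegree = n
  orthogonal : ∀ Q : ℝ[X], Q.degree < (n : WithBot ℕ) →
    ∫ x in Set.Icc a b, P.eval x * Q.eval x * w x = 0

/-- The monic orthogonal polynomial `P_n(·; w)` on `[a, b]`
(for a weight `w` it exists and is unique, see `existsUnique_isMonicOrthogonal`). -/
def orthoPoly (w : ℝ → ℝ) (a b : ℝ) (n : ℕ) : ℝ[X] :=
  Classical.epsilon (IsMonicOrthogonal w a b n)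

theorem IsWeight.integrable_eval_mul {w : ℝ → ℝ} {a b : ℝ} (hw : IsWeight w a b) (P : ℝ[X]) :
    Integrable (fun x => P.eval x * w x) (volume.restrict (Set.Icc a b)) :=
  IntegrableOn.continuousOn_mul P.continuous.continuousOn hw.integrable isCompact_Icc

theorem IsWeight.eq_zero_of_integral {w : ℝ → ℝ} {a b : ℝ} (hab : a < b) (hw : IsWeight w a b)
    (P : ℝ[X]) (h : ∫ x in Set.Icc a b, P.eval x * P.eval x * w x = 0) : P = 0 := by
  have hi := hw.integrable_eval_mul (P * P)
  simp only [eval_mul] at hi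
  have hnn : 0 ≤ᵐ[volume.restrict (Set.Icc a b)] fun x => P.eval x * P.eval x * w x := by
    filter_upwards [hw.pos] with x hx
    exact mul_nonneg (mul_self_nonneg _) hx.le
  have h0 := (integral_eq_zero_iff_of_nonneg_ae hnn hi).1 h
  have h1 : ∀ᵐ x ∂(volume.restrict (Set.Icc a b)), x ∈ P.rootSet ℝ ∨ P = 0 := by
    filter_upwards [h0, hw.pos] with x hx hpos
    by_cases hP : P = 0
    · exact Or.inr hP
    · left
      have hx' : P.eval x * P.eval x * w x = 0 := hx
      have : P.eval x = 0 := by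
        rcases mul_eq_zero.1 hx' with h | h
        · exact mul_self_eq_zero.1 h
        · exact absurd h hpos.ne'
      rw [mem_rootSet]
      exact ⟨hP, by simpa using this⟩
  by_contra hP
  have h2 : (volume.restrict (Set.Icc a b)) (P.rootSet ℝ)ᶜ = 0 := by
    rw [← mem_ae_iff]
    filter_upwards [h1] with x hx
    exact hx.resolve_right hP
  have h3 : (volume.restrict (Set.Icc a b)) (P.rootSet ℝ) = 0 :=
    le_antisymm ((Measure.restrict_apply_le _ _).trans
      ((P.rootSet_finite ℝ).measure_zero volume).le) bot_le
  have h4 : (volume.restrict (Set.Icc a b)) Set.univ = 0 := by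
    rw [← Set.union_compl_self (P.rootSet ℝ)]
    exact measure_union_null h3 h2
  rw [Measure.restrict_apply_univ, Real.volume_Icc, ENNReal.ofReal_eq_zero] at h4
  linarith

theorem existsUnique_isMonicOrthogonal {w : ℝ → ℝ} {a b : ℝ} (hab : a < b) (hw : IsWeight w a b)
    (n : ℕ) : ∃! P, IsMonicOrthogonal w a b n P := by
  have hint : ∀ P Q : ℝ[X],
      Integrable (fun x => P.eval x * Q.eval x * w x) (volume.restrict (Set.Icc a b)) := by
    intro P Q
    have := hw.integrable_eval_mul (P * Q)
    simpa only [eval_mul] using this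
  let B : ℝ[X] →ₗ[ℝ] ℝ[X] →ₗ[ℝ] ℝ := LinearMap.mk₂ ℝ
    (fun P Q => ∫ x in Set.Icc a b, P.eval x * Q.eval x * w x)
    (by
      intro P P' Q
      rw [← integral_add (hint P Q) (hint P' Q)]
      simp only [eval_add, add_mul])
    (by
      intro c P Q
      simp only [eval_smul, smul_eq_mul, mul_assoc, integral_const_mul])
    (by
      intro P Q Q'
      rw [← integral_add (hint P Q) (hint P Q')]
      simp only [eval_add, mul_add, add_mul])
    (by
      intro c P Q
      rw [smul_eq_mul, ← integral_const_mul]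
      congr 1
      ext x
      simp only [eval_smul, smul_eq_mul]
      ring)
  have hB : ∀ P Q, B P Q = ∫ x in Set.Icc a b, P.eval x * Q.eval x * w x := fun P Q => rfl
  let T : degreeLT ℝ n →ₗ[ℝ] Module.Dual ℝ (degreeLT ℝ n) :=
    (B.domRestrict₁₂ (degreeLT ℝ n) (degreeLT ℝ n))
  have hT : Function.Injective T := by
    rw [injective_iff_map_eq_zero]
    intro P hP
    have : T P P = 0 := by rw [hP]; rfl
    exact Subtype.ext (hw.eq_zero_of_integral hab P this)
  have : Module.Finite ℝ (degreeLT ℝ n) := Module.Finite.equiv (degreeLTEquiv ℝ n).symm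
  have hTs : Function.Surjective T :=
    (LinearMap.injective_iff_surjective_of_finrank_eq_finrank
      (Subspace.dual_finrank_eq).symm).1 hT
  obtain ⟨R, hR⟩ := hTs ((B (X ^ n)).domRestrict (degreeLT ℝ n))
  have hRdeg : (R : ℝ[X]).degree < (n : WithBot ℕ) := mem_degreeLT.1 R.2
  have hlt : (R : ℝ[X]).degree < (X ^ n : ℝ[X]).degree := by rwa [degree_X_pow]
  have key : IsMonicOrthogonal w a b n (X ^ n - (R : ℝ[X])) := by
    refine ⟨(monic_X_pow n).sub_of_left hlt, ?_, ?_⟩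
    · apply natDegree_eq_of_degree_eq_some
      rw [degree_sub_eq_left_of_degree_lt hlt, degree_X_pow]
    · intro Q hQ
      have h := LinearMap.congr_fun hR ⟨Q, mem_degreeLT.2 hQ⟩
      have h' : B R Q = B (X ^ n) Q := h
      rw [← hB, map_sub, LinearMap.sub_apply, h', sub_self]
  refine ⟨_, key, ?_⟩
  intro P hP
  set P₀ := X ^ n - (R : ℝ[X])
  have hd : (P - P₀).degree < (n : WithBot ℕ) := by
    have hP' : P.degree = n := by
      rw [degree_eq_natDegree hP.monic.ne_zero, hP.natDegree_eq]
    have hP₀ : P₀.degree = n := by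
      rw [degree_eq_natDegree key.monic.ne_zero, key.natDegree_eq]
    rw [← hP']
    exact degree_sub_lt_left (hP'.trans hP₀.symm) hP.monic.ne_zero
      (hP.monic.leadingCoeff.trans key.monic.leadingCoeff.symm)
  apply sub_eq_zero.1
  apply hw.eq_zero_of_integral hab
  rw [← hB]
  have h1 : B P (P - P₀) = 0 := hP.orthogonal _ hd
  have h2 : B P₀ (P - P₀) = 0 := key.orthogonal _ hd
  rw [LinearMap.map_sub₂, h1, h2, sub_self]

theorem isMonicOrthogonal_orthoPoly {w : ℝ → ℝ} {a b : ℝ} (hab : a < b) (hw : IsWeight w a b)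
    (n : ℕ) : IsMonicOrthogonal w a b n (orthoPoly w a b n) :=
  Classical.epsilon_spec (existsUnique_isMonicOrthogonal hab hw n).exists

/-- The rational modification `w̃(x) = (x - e₃) (e₂ - x) / (e₁ - x) · w(x)`. -/
def modifiedWeight (e₁ e₂ e₃ : ℝ) (w : ℝ → ℝ) (x : ℝ) : ℝ :=
  (x - e₃) * (e₂ - x) / (e₁ - x) * w x

theorem isWeight_modifiedWeight {e₁ e₂ e₃ : ℝ} (h21 : e₂ < e₁) {w : ℝ → ℝ}
    (hw : IsWeight w e₃ e₂) : IsWeight (modifiedWeight e₁ e₂ e₃ w) e₃ e₂ := by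
  refine ⟨?_, ?_⟩
  · refine IntegrableOn.continuousOn_mul (g := fun x => (x - e₃) * (e₂ - x) / (e₁ - x))
      ?_ hw.integrable isCompact_Icc
    refine ContinuousOn.div (by fun_prop) (by fun_prop) ?_
    intro x hx
    have := hx.2
    linarith
  · have h3 : ∀ᵐ x ∂(volume.restrict (Set.Icc e₃ e₂)), x ≠ e₃ := Measure.ae_ne _ _
    have h2 : ∀ᵐ x ∂(volume.restrict (Set.Icc e₃ e₂)), x ≠ e₂ := Measure.ae_ne _ _
    filter_upwards [hw.pos, h3, h2, ae_restrict_mem measurableSet_Icc] with x hx h3 h2 hI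
    have h3' : 0 < x - e₃ := sub_pos.2 (lt_of_le_of_ne hI.1 (Ne.symm h3))
    have h2' : 0 < e₂ - x := sub_pos.2 (lt_of_le_of_ne hI.2 h2)
    have h1' : 0 < e₁ - x := by linarith
    exact mul_pos (div_pos (mul_pos h3' h2') h1') hx

/-- The function on `ℂ` given by a real polynomial. -/
def realPolyFun (P : ℝ[X]) (z : ℂ) : ℂ := aeval z P

/-- The interval `[a, b]` as a curve in `ℂ`. -/
def realSegment (a b : ℝ) : Set ℂ := (fun t : ℝ => (t : ℂ)) '' Set.Icc a b

/-! ### Rectangular lattices and the lifted functions -/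

/-- The periods `2 ω₁ > 0` and `2 ω₃ = 2 i τ`, `τ > 0`, of a rectangular lattice. -/
def rectPeriods (ω₁ τ : ℝ) (hω : 0 < ω₁) (hτ : 0 < τ) : PeriodPair where
  ω₁ := 2 * ω₁
  ω₂ := 2 * (τ * I)
  indep := by
    rw [LinearIndependent.pair_iff]
    intro s t h
    have hre := congrArg Complex.re h
    have him := congrArg Complex.im h
    simp at hre him
    exact ⟨hre.resolve_right hω.ne', him.resolve_right hτ.ne'⟩

/-- The closed half contour `ω₃ + [0, 1] ω₁`, with `ω₃ = i τ`. -/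
def halfContour (ω₁ τ : ℝ) : Set ℂ := (fun t : ℝ => (τ * I + t * ω₁ : ℂ)) '' Set.Icc 0 1

/-- The open half contour `ω₃ + (0, 1) ω₁`, with `ω₃ = i τ`. -/
def openHalfContour (ω₁ τ : ℝ) : Set ℂ := (fun t : ℝ => (τ * I + t * ω₁ : ℂ)) '' Set.Ioo 0 1

/-- The lift `F_n` of the orthogonal polynomials of `w` and of its rational modification:
`F_{2j} = P_j(℘; w)` and `F_{2j+1} = -(1/2) ℘' / (℘ - e₁) P_j(℘; w̃)`. -/
def liftedFun (L : PeriodPair) (e₁ e₂ e₃ : ℝ) (w : ℝ → ℝ) (n : ℕ) (z : ℂ) : ℂ :=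
  if Even n then
    realPolyFun (orthoPoly w e₃ e₂ (n / 2)) (℘[L] z)
  else
    -(1 / 2) * (℘'[L] z / (℘[L] z - e₁)) *
      realPolyFun (orthoPoly (modifiedWeight e₁ e₂ e₃ w) e₃ e₂ (n / 2)) (℘[L] z)

end

/-! Both claims reduce to a sign statement. Let `p`, `q` be monic orthogonal polynomials of degrees
`n + 1` and `n`, with simple zeros inside the interval. If `p` has the sign opposite to `q'` at
every zero of `q`, then counting the zeros of `p` beyond each zero of `q` forces strict interlacing
(`interlacing_of_eval_mul_eval_neg`).

For a common weight the sign comes from testing `p` against `A = q / (X - y)`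
(`eval_mul_eval_neg_of_orthogonal`). For `w` and its modification, put `v = w / (e₁ - x)`: then `w =
(e₁ - x) v` and `w̃ = (x - e₃)(e₂ - x) v`, so both families belong to the single positive functional
of `v`. Interpolating `(e₁ - X) p` at `e₃`, `e₂`, `y` leaves a remainder killed by the orthogonality
of `q`, and the signs of `p` and `q` at the endpoints determine the sign at `y`
(`eval_mul_eval_neg_of_orthogonal_modified`).

On the half contour `℘` is real and strictly increasing from `e₃` to `e₂`, and `℘'` vanishes only at
the two ends, because its zeros are half-periods (`two_mul_mem_lattice`). Zeros therefore lift
through `℘` with order and multiplicity preserved. The factor `-(1/2) ℘' / (℘ - e₁)` adds only a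
simple zero at each end, so for odd indices the closed contour allows weak interlacing only. -/

/-! ### Positive functionals on polynomials and their orthogonal polynomials -/

/-- A linear functional on real polynomials that is positive on every nonzero polynomial that is
nonnegative on `(a, b)`. -/
def IsPositiveOn (Λ : ℝ[X] →ₗ[ℝ] ℝ) (a b : ℝ) : Prop :=
  ∀ R : ℝ[X], R ≠ 0 → (∀ x ∈ Set.Ioo a b, 0 ≤ R.eval x) → 0 < Λ R

theorem IsPositiveOn.mul_self_pos {Λ : ℝ[X] →ₗ[ℝ] ℝ} {a b : ℝ} (hΛ : IsPositiveOn Λ a b)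
    {R : ℝ[X]} (hR : R ≠ 0) : 0 < Λ (R * R) :=
  hΛ _ (mul_ne_zero hR hR) fun x _ => by rw [eval_mul]; exact mul_self_nonneg _

/-- The functional `R ↦ ∫ R w` of a weight `w` on `[a, b]`. -/
noncomputable def weightFunctional {w : ℝ → ℝ} {a b : ℝ} (hw : IsWeight w a b) :
    ℝ[X] →ₗ[ℝ] ℝ where
  toFun R := ∫ x in Set.Icc a b, R.eval x * w x
  map_add' P Q := by
    rw [← integral_add (hw.integrable_eval_mul P) (hw.integrable_eval_mul Q)]
    simp only [eval_add, add_mul]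
  map_smul' c P := by
    simp only [eval_smul, smul_eq_mul, mul_assoc, integral_const_mul, RingHom.id_apply]

theorem weightFunctional_apply {w : ℝ → ℝ} {a b : ℝ} (hw : IsWeight w a b) (R : ℝ[X]) :
    weightFunctional hw R = ∫ x in Set.Icc a b, R.eval x * w x := rfl

/-- The endpoints and the roots of `R` form a null set, so nonnegativity on the open interval
becomes positivity almost everywhere. -/
theorem IsWeight.eval_mul {w : ℝ → ℝ} {a b : ℝ} (hw : IsWeight w a b) {R : ℝ[X]} (hR : R ≠ 0)
    (h : ∀ x ∈ Set.Ioo a b, 0 ≤ R.eval x) : IsWeight (fun x => R.eval x * w x) a b := by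
  refine ⟨hw.integrable_eval_mul R, ?_⟩
  have h3 : ∀ᵐ x ∂(volume.restrict (Set.Icc a b)), x ≠ a := Measure.ae_ne _ _
  have h2 : ∀ᵐ x ∂(volume.restrict (Set.Icc a b)), x ≠ b := Measure.ae_ne _ _
  have h0 : ∀ᵐ x ∂(volume.restrict (Set.Icc a b)), x ∉ R.rootSet ℝ :=
    ((R.rootSet_finite ℝ).countable).ae_notMem _
  filter_upwards [hw.pos, h3, h2, h0, ae_restrict_mem measurableSet_Icc] with x hx h3 h2 h0 hI
  refine mul_pos (lt_of_le_of_ne (h x ⟨lt_of_le_of_ne hI.1 h3.symm, lt_of_le_of_ne hI.2 h2⟩) ?_) hx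
  intro hr
  exact h0 (by rw [mem_rootSet]; exact ⟨hR, by simpa using hr.symm⟩)

theorem isPositiveOn_weightFunctional {w : ℝ → ℝ} {a b : ℝ} (hab : a < b) (hw : IsWeight w a b) :
    IsPositiveOn (weightFunctional hw) a b := by
  intro R hR h
  have hw' := hw.eval_mul hR h
  rw [weightFunctional_apply]
  refine lt_of_le_of_ne (integral_nonneg_of_ae (hw'.pos.mono fun x hx => hx.le)) fun h0 => ?_
  -- With `R` absorbed into the weight, the integral is the squared norm of the constant `1`.
  refine one_ne_zero (hw'.eq_zero_of_integral hab 1 ?_)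
  simpa using h0.symm

/-! ### Zeros of orthogonal polynomials -/

theorem exists_eq_C_eval_add (B : ℝ[X]) (y : ℝ) : ∃ S : ℝ[X],
    B = C (B.eval y) + (X - C y) * S ∧ (B ≠ 0 → S.degree < B.degree) ∧
      S.natDegree = B.natDegree - 1 := by
  refine ⟨B /ₘ (X - C y), ?_, fun hB => ?_, ?_⟩
  · have := modByMonic_add_div B (X - C y)
    rw [modByMonic_X_sub_C_eq_C_eval] at this
    exact this.symm
  · exact degree_divByMonic_lt _ _ hB (by rw [degree_X_sub_C]; norm_num)
  · rw [natDegree_divByMonic _ (monic_X_sub_C y), natDegree_X_sub_C]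

/-- If a polynomial orthogonal to everything of lower degree is `u * v` with `deg v < n`, then `u`
is not of constant sign. -/
theorem not_nonneg_of_orthogonal {Λ : ℝ[X] →ₗ[ℝ] ℝ} {a b : ℝ} (hΛ : IsPositiveOn Λ a b) {n : ℕ}
    {P u v : ℝ[X]} (horth : ∀ Q : ℝ[X], Q.degree < (n : WithBot ℕ) → Λ (P * Q) = 0)
    (hP : P = u * v) (hP0 : P ≠ 0) (hv : v.degree < (n : WithBot ℕ)) :
    (¬ ∀ x ∈ Set.Ioo a b, 0 ≤ u.eval x) ∧ (¬ ∀ x ∈ Set.Ioo a b, u.eval x ≤ 0) := by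
  have hu0 : u ≠ 0 := by rintro rfl; simp [hP] at hP0
  have hv0 : v ≠ 0 := by rintro rfl; simp [hP] at hP0
  -- Testing `u * v` against `v` gives `Λ (u * v * v) = 0`, while a `u` of constant sign would make
  -- `u * v * v` of constant sign and nonzero.
  have h0 := horth v hv
  have hne : u * v * v ≠ 0 := mul_ne_zero (mul_ne_zero hu0 hv0) hv0
  constructor
  · intro h
    have := hΛ (P * v) (hP ▸ hne) fun x hx => by
      rw [hP, eval_mul, eval_mul, mul_assoc]
      exact mul_nonneg (h x hx) (mul_self_nonneg _)
    linarith
  · intro h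
    have := hΛ (-(P * v)) (neg_ne_zero.2 (hP ▸ hne)) fun x hx => by
      rw [hP, eval_neg, eval_mul, eval_mul, mul_assoc]
      exact neg_nonneg.2 (mul_nonpos_of_nonpos_of_nonneg (h x hx) (mul_self_nonneg _))
    rw [map_neg] at this
    linarith

/-- A monic polynomial with simple real roots, listed in increasing order. -/
theorem exists_sorted_roots {P : ℝ[X]} (hm : P.Monic) (hs : P.Splits) (hd : P.roots.Nodup) :
    ∃ x : ℕ → ℝ, (∀ i j, i < j → j < P.natDegree → x i < x j) ∧
      P = ∏ i ∈ Finset.range P.natDegree, (X - C (x i)) := by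
  set s := P.roots.toFinset with hsdef
  have hcard : s.card = P.natDegree := by
    rw [hsdef, Multiset.toFinset_card_of_nodup hd, hs.natDegree_eq_card_roots]
  let e := s.orderEmbOfFin hcard
  refine ⟨fun i => if h : i < P.natDegree then e ⟨i, h⟩ else 0, ?_, ?_⟩
  · intro i j hij hj
    simp only [hj, hij.trans hj, dif_pos]
    exact e.strictMono hij
  · have h1 : P = ∏ r ∈ s, (X - C r) := by
      conv_lhs => rw [hs.eq_prod_roots_of_monic hm]
      rw [Finset.prod, hsdef, Multiset.toFinset_val, hd.dedup]
    have h2 : ∏ r ∈ s, (X - C r) = ∏ i : Fin P.natDegree, (X - C (e i)) := by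
      have := s.image_orderEmbOfFin_univ hcard
      conv_lhs => rw [← this]
      rw [Finset.prod_image fun i _ j _ h => e.injective h]
    conv_lhs => rw [h1, h2]
    rw [Finset.prod_range]
    refine Finset.prod_congr rfl fun i _ => ?_
    simp

/-- The zeros of an orthogonal polynomial are real, simple and in the open interval. -/
theorem exists_roots_of_orthogonal {Λ : ℝ[X] →ₗ[ℝ] ℝ} {a b : ℝ} (hΛ : IsPositiveOn Λ a b) {n : ℕ}
    {P : ℝ[X]} (hm : P.Monic) (hn : P.natDegree = n)
    (horth : ∀ Q : ℝ[X], Q.degree < (n : WithBot ℕ) → Λ (P * Q) = 0) :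
    ∃ x : ℕ → ℝ, (∀ i j, i < j → j < n → x i < x j) ∧ (∀ i < n, x i ∈ Set.Ioo a b) ∧
      P = ∏ i ∈ Finset.range n, (X - C (x i)) := by
  have hP0 := hm.ne_zero
  have hdeg : P.degree = n := by rw [degree_eq_natDegree hP0, hn]
  -- Every factor of positive degree changes sign in `(a, b)`. This excludes linear factors with
  -- root outside, irreducible factors without a real root, and squares of linear factors.
  have key : ∀ u v : ℝ[X], P = u * v → 0 < u.degree →
      (¬ ∀ x ∈ Set.Ioo a b, 0 ≤ u.eval x) ∧ (¬ ∀ x ∈ Set.Ioo a b, u.eval x ≤ 0) := by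
    intro u v huv hu
    refine not_nonneg_of_orthogonal hΛ horth huv hP0 ?_
    have hu0 : u ≠ 0 := by rintro rfl; simp [huv] at hP0
    have hv0 : v ≠ 0 := by rintro rfl; simp [huv] at hP0
    have h1 := natDegree_mul hu0 hv0
    rw [← huv, hn] at h1
    have h2 := natDegree_pos_iff_degree_pos.2 hu
    rw [degree_eq_natDegree hv0]
    exact_mod_cast (by omega : v.natDegree < n)
  have hroot : ∀ r, P.eval r = 0 → r ∈ Set.Ioo a b := by
    intro r hr
    obtain ⟨v, hv⟩ := dvd_iff_isRoot.2 hr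
    have h := key _ v hv (by rw [degree_X_sub_C]; norm_num)
    by_contra hmem
    rcases le_or_gt r a with h' | h'
    · refine h.1 fun x hx => ?_
      have := hx.1
      simp; linarith
    · refine h.2 fun x hx => ?_
      have h2 : b ≤ r := by
        by_contra h3
        exact hmem ⟨h', not_le.1 h3⟩
      have := hx.2
      simp; linarith
  have hs : P.Splits := by
    rw [splits_iff_splits]
    refine Or.inr fun {g} hg hgP => ?_
    by_contra hne
    obtain ⟨v, hv⟩ := hgP
    have hnr : ∀ x, g.eval x ≠ 0 := fun x hx =>
      hne (degree_eq_one_of_irreducible_of_root hg hx)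
    have h := key g v hv (degree_pos_of_irreducible hg)
    have hsign : (∀ x, 0 ≤ g.eval x) ∨ ∀ x, g.eval x ≤ 0 := by
      by_contra hcon
      push Not at hcon
      obtain ⟨⟨s, hs⟩, ⟨t, ht⟩⟩ := hcon
      obtain ⟨z, hz⟩ := mem_range_of_exists_le_of_exists_ge g.continuous ⟨s, hs.le⟩ ⟨t, ht.le⟩
      exact hnr z hz
    rcases hsign with h' | h'
    · exact h.1 fun x _ => h' x
    · exact h.2 fun x _ => h' x
  have hd : P.roots.Nodup := by
    rw [Multiset.nodup_iff_count_le_one]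
    intro r
    by_contra hc
    rw [count_roots, not_le] at hc
    obtain ⟨v, hv⟩ := (le_rootMultiplicity_iff hP0).1 hc
    have h := key _ v hv (by rw [degree_pow, degree_X_sub_C]; norm_num)
    exact h.1 fun x _ => by rw [eval_pow]; exact (even_two).pow_nonneg _
  obtain ⟨x, hx1, hx2⟩ := exists_sorted_roots hm hs hd
  rw [hn] at hx1 hx2
  refine ⟨x, hx1, fun i hi => hroot _ ?_, hx2⟩
  rw [hx2, eval_prod]
  exact Finset.prod_eq_zero (Finset.mem_range.2 hi) (by simp)

/-- A one-node quadrature: `B` differs from its value at `y` by a multiple of `X - y`, which `M`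
annihilates. When `Λ (M * B)` is known to be positive, it gives `Λ M` the sign of `B.eval y`. -/
theorem apply_mul_eq_eval_mul {Λ : ℝ[X] →ₗ[ℝ] ℝ} {n : ℕ} {M B : ℝ[X]} {y : ℝ}
    (hM : ∀ S : ℝ[X], S.degree < (n : WithBot ℕ) → Λ (M * (X - C y) * S) = 0)
    (hB : B.degree ≤ (n : WithBot ℕ)) : Λ (M * B) = B.eval y * Λ M := by
  rcases eq_or_ne B 0 with rfl | hB0
  · simp
  obtain ⟨S, hS, hdeg, -⟩ := exists_eq_C_eval_add B y
  have h : M * B = B.eval y • M + M * (X - C y) * S := by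
    conv_lhs => rw [hS]
    rw [smul_eq_C_mul]
    ring
  rw [h, map_add, map_smul, hM S ((hdeg hB0).trans_le hB), add_zero, smul_eq_mul]

/-- At a zero `y` of the orthogonal polynomial `q = (X - y) A` of degree `n`, the next orthogonal
polynomial `p` has the sign opposite to `q'(y) = A(y)`. -/
theorem eval_mul_eval_neg_of_orthogonal {Λ : ℝ[X] →ₗ[ℝ] ℝ} {a b : ℝ} (hΛ : IsPositiveOn Λ a b)
    {n : ℕ} {p q A : ℝ[X]} {y : ℝ} (hp : p.Monic) (hpn : p.natDegree = n + 1)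
    (hq : q.Monic) (hqn : q.natDegree = n)
    (hpo : ∀ Q : ℝ[X], Q.degree < ((n + 1 : ℕ) : WithBot ℕ) → Λ (p * Q) = 0)
    (hqo : ∀ Q : ℝ[X], Q.degree < (n : WithBot ℕ) → Λ (q * Q) = 0)
    (hA : q = (X - C y) * A) : p.eval y * A.eval y < 0 := by
  have hA0 : A ≠ 0 := by rintro rfl; exact hq.ne_zero (by simpa using hA)
  have hqd : q.degree = n := by rw [degree_eq_natDegree hq.ne_zero, hqn]
  have hAm : A.Monic := (monic_X_sub_C y).of_mul_monic_left (hA ▸ hq)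
  have hAd : A.degree ≤ (n : WithBot ℕ) := by
    rw [← hqd]
    exact degree_le_of_dvd (hA ▸ Dvd.intro_left _ rfl) hq.ne_zero
  have h1 : Λ (A * A) = A.eval y * Λ A := apply_mul_eq_eval_mul (n := n)
    (fun S hS => by rw [mul_comm A, ← hA]; exact hqo S hS) hAd
  have h2 : 0 < Λ (A * A) := hΛ.mul_self_pos hA0
  obtain ⟨R, hR, -, hRn⟩ := exists_eq_C_eval_add p y
  rw [hpn, Nat.add_sub_cancel] at hRn
  have hpR : (p - C (p.eval y)) = (X - C y) * R := by
    conv_lhs => rw [hR]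
    simp
  have hRm : R.Monic := by
    refine (monic_X_sub_C y).of_mul_monic_left ?_
    rw [← hpR]
    refine hp.sub_of_left (lt_of_le_of_lt degree_C_le ?_)
    rw [degree_eq_natDegree hp.ne_zero, hpn]
    exact_mod_cast Nat.succ_pos n
  have hRd : R.degree = n := by rw [degree_eq_natDegree hRm.ne_zero, hRn]
  have hS : (R - q).degree < (n : WithBot ℕ) := by
    rw [← hRd]
    exact degree_sub_lt_left (hRd.trans hqd.symm) hRm.ne_zero
      (hRm.leadingCoeff.trans hq.leadingCoeff.symm)
  have h3 : Λ (p * A) = 0 := hpo A (hAd.trans_lt (by exact_mod_cast Nat.lt_succ_self n))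
  -- Since `(X - y) A = q`, dividing `p` by `X - y` gives `p A = p(y) A + q R`. Both `R` and `q` are
  -- monic of degree `n`, so `Λ (q R) = Λ (q q) > 0`, and `Λ (p A) = 0` makes `p(y) Λ A` negative.
  have h4 : p * A = p.eval y • A + (q * q + q * (R - q)) := by
    conv_lhs => rw [hR]
    rw [smul_eq_C_mul, hA]
    ring
  have h5 : 0 < Λ (q * q) := hΛ.mul_self_pos hq.ne_zero
  rw [h4, map_add, map_add, map_smul, hqo _ hS, smul_eq_mul] at h3
  have h6 : p.eval y * Λ A < 0 := by linarith
  have h7 : 0 < A.eval y * Λ A := h1 ▸ h2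
  have h8 : (p.eval y * A.eval y) * (Λ A * Λ A) < 0 := by
    calc _ = (p.eval y * Λ A) * (A.eval y * Λ A) := by ring
      _ < 0 := mul_neg_of_neg_of_pos h6 h7
  exact neg_of_mul_neg_left h8 (mul_self_nonneg _)

/-- Interpolation at three nodes. -/
theorem exists_interpolation_three (f : ℝ[X]) {a b y : ℝ} (hab : a ≠ b) (hay : a ≠ y)
    (hby : b ≠ y) : ∃ R : ℝ[X], R.natDegree ≤ f.natDegree - 3 ∧
      f = C (f.eval a / ((a - y) * (a - b))) * ((X - C y) * (X - C b)) +
        C (f.eval y / ((y - a) * (y - b))) * ((X - C a) * (X - C b)) +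
        C (f.eval b / ((b - a) * (b - y))) * ((X - C a) * (X - C y)) +
        (X - C a) * (X - C b) * (X - C y) * R := by
  -- Three successive divisions give the Newton form, which is then compared pointwise with the
  -- Lagrange form.
  obtain ⟨f₁, h₁, -, d₁⟩ := exists_eq_C_eval_add f a
  obtain ⟨f₂, h₂, -, d₂⟩ := exists_eq_C_eval_add f₁ b
  obtain ⟨R, h₃, -, d₃⟩ := exists_eq_C_eval_add f₂ y
  refine ⟨R, by omega, ?_⟩
  set α := f.eval a
  set β := f₁.eval b
  set γ := f₂.eval y
  have hb : f.eval b = α + (b - a) * β := by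
    conv_lhs => rw [h₁]
    simp [β]
  have hy : f.eval y = α + (y - a) * (β + (y - b) * γ) := by
    conv_lhs => rw [h₁, h₂]
    simp [γ]
  have hf : f = C α + (X - C a) * (C β + (X - C b) * (C γ + (X - C y) * R)) := by
    rw [← h₃, ← h₂, ← h₁]
  conv_lhs => rw [hf]
  rw [hb, hy]
  refine Polynomial.funext fun x => ?_
  have e1 := sub_ne_zero.2 hab
  have e2 := sub_ne_zero.2 hay
  have e3 := sub_ne_zero.2 hby
  have e4 := sub_ne_zero.2 hab.symm
  have e5 := sub_ne_zero.2 hay.symm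
  have e6 := sub_ne_zero.2 hby.symm
  simp only [eval_add, eval_mul, eval_sub, eval_X, eval_C]
  field_simp
  ring

/-- Let `p` be orthogonal of degree `n + 1` for the functional `Λ((c - X) ·)` and `q` orthogonal of
degree `n` for the functional `Λ((X - a) (b - X) ·)`. At a zero of `q`, the values of `p` and of
`q'` have opposite signs. -/
theorem eval_mul_eval_neg_of_orthogonal_modified {Λ : ℝ[X] →ₗ[ℝ] ℝ} {a b c : ℝ} (hab : a < b)
    (hbc : b < c) (hΛ : IsPositiveOn Λ a b)
    {n : ℕ} {p q A : ℝ[X]} {y : ℝ} (hy : y ∈ Set.Ioo a b) (hpn : p.natDegree = n + 1)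
    (hq : q.Monic) (hqn : q.natDegree = n)
    (hpo : ∀ Q : ℝ[X], Q.degree < ((n + 1 : ℕ) : WithBot ℕ) → Λ ((C c - X) * (p * Q)) = 0)
    (hqo : ∀ Q : ℝ[X], Q.degree < (n : WithBot ℕ) → Λ ((X - C a) * (C b - X) * (q * Q)) = 0)
    (ha : p.eval a * q.eval a < 0) (hb : 0 < p.eval b * q.eval b)
    (hA : q = (X - C y) * A) : p.eval y * A.eval y < 0 := by
  obtain ⟨hay, hyb⟩ := hy
  have hA0 : A ≠ 0 := by rintro rfl; exact hq.ne_zero (by simpa using hA)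
  have hqd : q.degree = n := by rw [degree_eq_natDegree hq.ne_zero, hqn]
  have hAd : A.degree ≤ (n : WithBot ℕ) := by
    rw [← hqd]
    exact degree_le_of_dvd (hA ▸ Dvd.intro_left _ rfl) hq.ne_zero
  -- Needed below: the remainder has degree at most `n + 2 - 3`, which is less than `n` only for
  -- positive `n`.
  have hn : 0 < n := by
    have := natDegree_mul (X_sub_C_ne_zero y) hA0
    rw [← hA, hqn, natDegree_X_sub_C] at this
    omega
  -- the three positive quadratures
  have hE1 : Λ (q * (C b - X) * q) = q.eval a * Λ (q * (C b - X)) := apply_mul_eq_eval_mul (n := n)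
    (fun S hS => by rw [← hqo S hS]; congr 1; ring) hqd.le
  have hE1' : 0 < Λ (q * (C b - X) * q) := by
    refine hΛ _ (mul_ne_zero (mul_ne_zero hq.ne_zero ?_) hq.ne_zero) fun x hx => ?_
    · rw [← neg_sub]; exact neg_ne_zero.2 (X_sub_C_ne_zero b)
    · have := hx.2
      simp only [eval_mul, eval_sub, eval_X, eval_C]
      nlinarith [mul_nonneg (sub_nonneg.2 this.le) (mul_self_nonneg (q.eval x))]
  have hE3 : Λ (q * (X - C a) * q) = q.eval b * Λ (q * (X - C a)) := apply_mul_eq_eval_mul (n := n)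
    (fun S hS => by
      rw [← neg_eq_zero, ← map_neg, ← hqo S hS]; congr 1; ring) hqd.le
  have hE3' : 0 < Λ (q * (X - C a) * q) := by
    refine hΛ _ (mul_ne_zero (mul_ne_zero hq.ne_zero (X_sub_C_ne_zero a)) hq.ne_zero)
      fun x hx => ?_
    have := hx.1
    simp only [eval_mul, eval_sub, eval_X, eval_C]
    nlinarith [mul_nonneg (sub_nonneg.2 this.le) (mul_self_nonneg (q.eval x))]
  have hE2 : Λ ((X - C a) * (C b - X) * A * A) = A.eval y * Λ ((X - C a) * (C b - X) * A) :=
    apply_mul_eq_eval_mul (n := n)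
      (fun S hS => by rw [← hqo S hS, hA]; congr 1; ring) hAd
  have hE2' : 0 < Λ ((X - C a) * (C b - X) * A * A) := by
    refine hΛ _ (mul_ne_zero (mul_ne_zero (mul_ne_zero (X_sub_C_ne_zero a) ?_) hA0) hA0)
      fun x hx => ?_
    · rw [← neg_sub]; exact neg_ne_zero.2 (X_sub_C_ne_zero b)
    · simp only [eval_mul, eval_sub, eval_X, eval_C]
      rw [mul_assoc]
      exact mul_nonneg (mul_nonneg (sub_nonneg.2 hx.1.le) (sub_nonneg.2 hx.2.le))
        (mul_self_nonneg _)
  obtain ⟨R, hRn, hR⟩ := exists_interpolation_three ((C c - X) * p) hab.ne hay.ne hyb.ne'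
  have hRd : R.degree < (n : WithBot ℕ) := by
    refine degree_le_natDegree.trans_lt ?_
    have h1 : ((C c - X) * p).natDegree ≤ n + 2 := by
      refine natDegree_mul_le.trans ?_
      have : (C c - X : ℝ[X]).natDegree ≤ 1 := by
        rw [← neg_sub, natDegree_neg, natDegree_X_sub_C]
      omega
    exact_mod_cast (by omega : R.natDegree < n)
  have h0 : Λ ((C c - X) * (p * A)) = 0 :=
    hpo A (hAd.trans_lt (by exact_mod_cast Nat.lt_succ_self n))
  set α := ((C c - X) * p).eval a / ((a - y) * (a - b)) with hα
  set β := ((C c - X) * p).eval y / ((y - a) * (y - b)) with hβ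
  set γ := ((C c - X) * p).eval b / ((b - a) * (b - y)) with hγ
  -- Each Lagrange term times `A` is one of the three quadratures, and the remainder carries `(X -
  -- a)(b - X) q`. The signs of `-α` and `-β` come from writing `X - b` as `-(b - X)`.
  have h1 : (C c - X) * (p * A) = (-α) • (q * (C b - X)) + (-β) • ((X - C a) * (C b - X) * A) +
      γ • (q * (X - C a)) - (X - C a) * (C b - X) * (q * R) := by
    rw [← mul_assoc, hR]
    simp only [smul_eq_C_mul, C_neg]
    rw [hA]
    ring
  rw [h1, map_sub, hqo R hRd, sub_zero, map_add, map_add, map_smul, map_smul, map_smul,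
    smul_eq_mul, smul_eq_mul, smul_eq_mul] at h0
  have s1 : 0 < (-α) * Λ (q * (C b - X)) := by
    rw [hE1] at hE1'
    have : α * q.eval a < 0 := by
      rw [hα, div_mul_eq_mul_div]
      refine div_neg_of_neg_of_pos ?_ (mul_pos_of_neg_of_neg (by linarith) (by linarith))
      simp only [eval_mul, eval_sub, eval_X, eval_C]
      rw [mul_assoc]
      exact mul_neg_of_pos_of_neg (by linarith) ha
    have h2 : (α * Λ (q * (C b - X))) * (q.eval a * q.eval a) < 0 := by
      calc _ = (α * q.eval a) * (q.eval a * Λ (q * (C b - X))) := by ring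
        _ < 0 := mul_neg_of_neg_of_pos this hE1'
    have := neg_of_mul_neg_left h2 (mul_self_nonneg _)
    linarith
  have s3 : 0 < γ * Λ (q * (X - C a)) := by
    rw [hE3] at hE3'
    have : 0 < γ * q.eval b := by
      rw [hγ, div_mul_eq_mul_div]
      refine div_pos ?_ (mul_pos (by linarith) (by linarith))
      simp only [eval_mul, eval_sub, eval_X, eval_C]
      rw [mul_assoc]
      exact mul_pos (by linarith) hb
    have h2 : 0 < (γ * Λ (q * (X - C a))) * (q.eval b * q.eval b) := by
      calc 0 < (γ * q.eval b) * (q.eval b * Λ (q * (X - C a))) := mul_pos this hE3'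
        _ = _ := by ring
    exact pos_of_mul_pos_left h2 (mul_self_nonneg _)
  -- The three terms sum to zero and the two endpoint terms are positive, so the middle one, `-β
  -- Λ(…)`, is negative.
  have s2 : 0 < β * Λ ((X - C a) * (C b - X) * A) := by linarith
  rw [hE2] at hE2'
  have s4 : 0 < β * A.eval y := by
    have h2 : 0 < (β * A.eval y) *
        (Λ ((X - C a) * (C b - X) * A) * Λ ((X - C a) * (C b - X) * A)) := by
      calc 0 < (β * Λ ((X - C a) * (C b - X) * A)) *
            (A.eval y * Λ ((X - C a) * (C b - X) * A)) := mul_pos s2 hE2'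
        _ = _ := by ring
    exact pos_of_mul_pos_left h2 (mul_self_nonneg _)
  have hD : (y - a) * (y - b) < 0 := mul_neg_of_pos_of_neg (by linarith) (by linarith)
  have s5 : β * ((y - a) * (y - b)) = (c - y) * p.eval y := by
    rw [hβ, div_mul_cancel₀ _ hD.ne]
    simp
  have s6 : (p.eval y * A.eval y) * (c - y) < 0 := by
    calc _ = (β * A.eval y) * ((y - a) * (y - b)) := by linear_combination -A.eval y * s5
      _ < 0 := mul_neg_of_pos_of_neg s4 hD
  exact neg_of_mul_neg_left s6 (by linarith)

/-! ### Interlacing from signs -/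

theorem prod_sub_eq_neg_one_pow_mul {ι : Type*} (s : Finset ι) (g : ι → ℝ) (t : ℝ) :
    ∏ i ∈ s, (t - g i) = (-1) ^ (s.filter (fun i => t < g i)).card * ∏ i ∈ s, |t - g i| := by
  classical
  induction s using Finset.induction_on with
  | empty => simp
  | insert i s hi ih =>
    rw [Finset.prod_insert hi, Finset.prod_insert hi, ih, Finset.filter_insert]
    split_ifs with h
    · rw [Finset.card_insert_of_notMem (by simp [hi]), abs_of_neg (sub_neg.2 h), pow_succ]
      ring
    · rw [abs_of_nonneg (sub_nonneg.2 (not_lt.1 h))]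
      ring

/-- Let `N k` count the zeros of `p` beyond `y k`. Exactly `n - 1 - k` zeros of `q` lie there, so
the sign hypothesis gives `N k` the parity of `n - k`. As `N` is nonincreasing with alternating
parity, it drops at every step; the bounds at the two ends of the list then leave only `N k = n -
k`. -/
theorem interlacing_of_eval_mul_eval_neg {n : ℕ} {x y : ℕ → ℝ} {p q : ℝ[X]}
    (hx : ∀ i j, i < j → j < n + 1 → x i < x j) (hy : ∀ i j, i < j → j < n → y i < y j)
    (hp : p = ∏ i ∈ Finset.range (n + 1), (X - C (x i)))
    (hq : q = ∏ i ∈ Finset.range n, (X - C (y i)))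
    (h : ∀ k < n, ∀ A, q = (X - C (y k)) * A → p.eval (y k) * A.eval (y k) < 0) :
    ∀ k < n, x k < y k ∧ y k < x (k + 1) := by
  set N : ℕ → ℕ := fun k => ((Finset.range (n + 1)).filter (fun i => y k < x i)).card with hN
  have hpe : ∀ t, p.eval t = ∏ i ∈ Finset.range (n + 1), (t - x i) := by
    intro t
    rw [hp, eval_prod]
    simp
  have hpar : ∀ k < n, Odd (N k + (n - 1 - k)) := by
    intro k hk
    have hA := h k hk (∏ i ∈ (Finset.range n).erase k, (X - C (y i)))
      (by rw [hq, Finset.mul_prod_erase _ (fun i => X - C (y i)) (Finset.mem_range.2 hk)])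
    have hM : (((Finset.range n).erase k).filter (fun i => y k < y i)).card = n - 1 - k := by
      have : ((Finset.range n).erase k).filter (fun i => y k < y i) = Finset.Ioo k n := by
        ext j
        simp only [Finset.mem_filter, Finset.mem_erase, Finset.mem_range, Finset.mem_Ioo]
        constructor
        · rintro ⟨⟨h1, h2⟩, h3⟩
          refine ⟨?_, h2⟩
          by_contra h4
          exact (hy j k (by omega) hk).not_gt h3
        · rintro ⟨h1, h2⟩
          exact ⟨⟨by omega, h2⟩, hy k j h1 h2⟩
      rw [this, Nat.card_Ioo]
      omega
    rw [hpe, eval_prod] at hA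
    simp only [eval_sub, eval_X, eval_C] at hA
    rw [prod_sub_eq_neg_one_pow_mul, prod_sub_eq_neg_one_pow_mul ((Finset.range n).erase k), hM]
      at hA
    by_contra hodd
    rw [Nat.not_odd_iff_even] at hodd
    refine hA.not_ge ?_
    rw [mul_mul_mul_comm, ← pow_add, hodd.neg_one_pow, one_mul]
    exact mul_nonneg (Finset.prod_nonneg fun _ _ => abs_nonneg _)
      (Finset.prod_nonneg fun _ _ => abs_nonneg _)
  have hanti : ∀ k, k + 1 < n → N (k + 1) ≤ N k := by
    intro k hk
    refine Finset.card_le_card fun i hi => ?_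
    rw [Finset.mem_filter] at hi ⊢
    exact ⟨hi.1, (hy k (k + 1) (Nat.lt_succ_self k) hk).trans hi.2⟩
  have hle : ∀ k, N k ≤ n + 1 := fun k =>
    (Finset.card_filter_le _ _).trans (Finset.card_range _).le
  -- The start is `N 0 ≤ n + 1`, improved by one through parity.
  have hupper : ∀ k, k < n → N k ≤ n - k := by
    intro k
    induction k with
    | zero =>
      intro hk
      obtain ⟨r, hr⟩ := hpar 0 hk
      have := hle 0
      omega
    | succ k ih =>
      intro hk
      obtain ⟨r, hr⟩ := hpar (k + 1) hk
      have := ih (by omega)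
      have := hanti k hk
      omega
  -- Induction from the last zero backwards: there `N` is odd, hence at least one.
  have hlower : ∀ j k, j + k + 1 = n → j + 1 ≤ N k := by
    intro j
    induction j with
    | zero =>
      intro k hk
      obtain ⟨r, hr⟩ := hpar k (by omega)
      omega
    | succ j ih =>
      intro k hk
      obtain ⟨r, hr⟩ := hpar k (by omega)
      have := ih (k + 1) (by omega)
      have := hanti k (by omega)
      omega
  intro k hk
  have hNk : N k = n - k := le_antisymm (hupper k hk) (by have := hlower (n - 1 - k) k; omega)
  constructor
  · rcases lt_trichotomy (x k) (y k) with h1 | h1 | h1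
    · exact h1
    -- `N k` counts strictly larger zeros only, so a common zero has to be excluded by the strict
    -- sign.
    · exfalso
      have hA := h k hk (∏ i ∈ (Finset.range n).erase k, (X - C (y i)))
        (by rw [hq, Finset.mul_prod_erase _ (fun i => X - C (y i)) (Finset.mem_range.2 hk)])
      rw [hpe, Finset.prod_eq_zero (Finset.mem_range.2 (by omega : k < n + 1))
        (sub_eq_zero.2 h1.symm), zero_mul] at hA
      exact lt_irrefl _ hA
    · exfalso
      have : (Finset.Ico k (n + 1)).card ≤ N k := by
        refine Finset.card_le_card fun i hi => ?_
        rw [Finset.mem_Ico] at hi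
        rw [Finset.mem_filter, Finset.mem_range]
        refine ⟨hi.2, ?_⟩
        rcases hi.1.eq_or_lt with rfl | h2
        · exact h1
        · exact h1.trans (hx k i h2 hi.2)
      rw [Nat.card_Ico] at this
      omega
  · by_contra h1
    have : N k ≤ (Finset.Ico (k + 2) (n + 1)).card := by
      refine Finset.card_le_card fun i hi => ?_
      rw [Finset.mem_filter, Finset.mem_range] at hi
      rw [Finset.mem_Ico]
      refine ⟨?_, hi.1⟩
      by_contra h2
      rcases (show i ≤ k + 1 by omega).eq_or_lt with rfl | h3
      · exact h1 hi.2
      · exact h1 (hi.2.trans (hx i (k + 1) h3 (by omega)))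
    rw [Nat.card_Ico] at this
    omega

/-! ### Zeros of the orthogonal polynomials of a weight -/

/-- `x 0 < … < x (n - 1)` are the zeros of the monic polynomial `P`, all in `(a, b)`. -/
structure HasSortedZeros (P : ℝ[X]) (a b : ℝ) (n : ℕ) (x : ℕ → ℝ) : Prop where
  lt : ∀ i j, i < j → j < n → x i < x j
  mem : ∀ i < n, x i ∈ Set.Ioo a b
  eq_prod : P = ∏ i ∈ Finset.range n, (X - C (x i))

theorem HasSortedZeros.eval_eq {P : ℝ[X]} {a b : ℝ} {n : ℕ} {x : ℕ → ℝ}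
    (h : HasSortedZeros P a b n x) (t : ℝ) : P.eval t = ∏ i ∈ Finset.range n, (t - x i) := by
  rw [h.eq_prod, eval_prod]
  simp

theorem HasSortedZeros.eval_right_pos {P : ℝ[X]} {a b : ℝ} {n : ℕ} {x : ℕ → ℝ}
    (h : HasSortedZeros P a b n x) : 0 < P.eval b := by
  rw [h.eval_eq]
  exact Finset.prod_pos fun i hi => sub_pos.2 (h.mem i (Finset.mem_range.1 hi)).2

theorem HasSortedZeros.eval_left_pos {P : ℝ[X]} {a b : ℝ} {n : ℕ} {x : ℕ → ℝ}
    (h : HasSortedZeros P a b n x) : 0 < (-1) ^ n * P.eval a := by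
  have : (-1 : ℝ) ^ n = ∏ i ∈ Finset.range n, (-1) := by simp
  rw [h.eval_eq, this, ← Finset.prod_mul_distrib]
  refine Finset.prod_pos fun i hi => ?_
  have := (h.mem i (Finset.mem_range.1 hi)).1
  linarith

theorem IsWeight.orthogonal_weightFunctional {w : ℝ → ℝ} {a b : ℝ} (hw : IsWeight w a b)
    {n : ℕ} {P : ℝ[X]} (hP : IsMonicOrthogonal w a b n P) (Q : ℝ[X])
    (hQ : Q.degree < (n : WithBot ℕ)) : weightFunctional hw (P * Q) = 0 := by
  rw [weightFunctional_apply, ← hP.orthogonal Q hQ]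
  simp only [Polynomial.eval_mul]

theorem exists_hasSortedZeros_orthoPoly {w : ℝ → ℝ} {a b : ℝ} (hab : a < b) (hw : IsWeight w a b)
    (n : ℕ) : ∃ x, HasSortedZeros (orthoPoly w a b n) a b n x := by
  have h := isMonicOrthogonal_orthoPoly hab hw n
  obtain ⟨x, h1, h2, h3⟩ := exists_roots_of_orthogonal (isPositiveOn_weightFunctional hab hw)
    h.monic h.natDegree_eq (hw.orthogonal_weightFunctional h)
  exact ⟨x, h1, h2, h3⟩

theorem interlacing_orthoPoly_succ {w : ℝ → ℝ} {a b : ℝ} (hab : a < b) (hw : IsWeight w a b)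
    {n : ℕ} {x y : ℕ → ℝ} (hx : HasSortedZeros (orthoPoly w a b (n + 1)) a b (n + 1) x)
    (hy : HasSortedZeros (orthoPoly w a b n) a b n y) :
    ∀ k < n, x k < y k ∧ y k < x (k + 1) := by
  have hp := isMonicOrthogonal_orthoPoly hab hw (n + 1)
  have hq := isMonicOrthogonal_orthoPoly hab hw n
  exact interlacing_of_eval_mul_eval_neg hx.lt hy.lt hx.eq_prod hy.eq_prod fun k _ A hA =>
    eval_mul_eval_neg_of_orthogonal (isPositiveOn_weightFunctional hab hw) hp.monic
      hp.natDegree_eq hq.monic hq.natDegree_eq (hw.orthogonal_weightFunctional hp)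
      (hw.orthogonal_weightFunctional hq) hA

/-- With `c = e₁` this is the common weight `v` of which `w` and its modification are both
polynomial multiples on the interval. -/
theorem IsWeight.div_sub {w : ℝ → ℝ} {a b c : ℝ} (hbc : b < c) (hw : IsWeight w a b) :
    IsWeight (fun x => (c - x)⁻¹ * w x) a b := by
  refine ⟨?_, ?_⟩
  · refine IntegrableOn.continuousOn_mul (ContinuousOn.inv₀ (by fun_prop) ?_) hw.integrable
      isCompact_Icc
    intro x hx
    have := hx.2
    linarith
  · filter_upwards [hw.pos, ae_restrict_mem measurableSet_Icc] with x hx hI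
    have := hI.2
    exact mul_pos (inv_pos.2 (by linarith)) hx

theorem interlacing_orthoPoly_modifiedWeight {w : ℝ → ℝ} {e₁ e₂ e₃ : ℝ} (h32 : e₃ < e₂)
    (h21 : e₂ < e₁) (hw : IsWeight w e₃ e₂) {n : ℕ} {x y : ℕ → ℝ}
    (hx : HasSortedZeros (orthoPoly w e₃ e₂ (n + 1)) e₃ e₂ (n + 1) x)
    (hy : HasSortedZeros (orthoPoly (modifiedWeight e₁ e₂ e₃ w) e₃ e₂ n) e₃ e₂ n y) :
    ∀ k < n, x k < y k ∧ y k < x (k + 1) := by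
  have hw' := isWeight_modifiedWeight h21 hw
  have hv := hw.div_sub h21
  have hp := isMonicOrthogonal_orthoPoly h32 hw (n + 1)
  have hq := isMonicOrthogonal_orthoPoly h32 hw' n
  refine interlacing_of_eval_mul_eval_neg hx.lt hy.lt hx.eq_prod hy.eq_prod fun k hk A hA =>
    eval_mul_eval_neg_of_orthogonal_modified h32 h21 (isPositiveOn_weightFunctional h32 hv)
      (hy.mem k hk) hp.natDegree_eq hq.monic hq.natDegree_eq ?_ ?_ ?_ ?_ hA
  · intro Q hQ
    rw [weightFunctional_apply, ← hp.orthogonal Q hQ]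
    refine setIntegral_congr_fun measurableSet_Icc fun t ht => ?_
    have : e₁ - t ≠ 0 := by have := ht.2; linarith
    simp only [Polynomial.eval_mul, eval_sub, eval_X, eval_C]
    field_simp
  · intro Q hQ
    rw [weightFunctional_apply, ← hq.orthogonal Q hQ]
    refine setIntegral_congr_fun measurableSet_Icc fun t ht => ?_
    have : e₁ - t ≠ 0 := by have := ht.2; linarith
    simp only [Polynomial.eval_mul, eval_sub, eval_X, eval_C, modifiedWeight]
    field_simp
  -- At the left end the signs are `(-1) ^ (n + 1)` and `(-1) ^ n`, whose product is negative.
  · have h1 := mul_pos hx.eval_left_pos hy.eval_left_pos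
    rw [mul_mul_mul_comm, ← pow_add, show n + 1 + n = 2 * n + 1 by ring, pow_succ, pow_mul] at h1
    simp at h1
    linarith
  · exact mul_pos hx.eval_right_pos hy.eval_right_pos

/-! ### The Weierstrass function -/

namespace PeriodPair

open Filter Topology

variable (L : PeriodPair)

theorem countable_lattice : (L.lattice : Set ℂ).Countable := by
  have : Countable L.lattice := L.latticeEquivProd.toEquiv.countable_iff.2 inferInstance
  exact Set.countable_coe_iff.1 this

/-- Removing a countable set does not disconnect the plane; this allows the identity theorem off the
poles. -/
theorem isPreconnected_compl_lattice : IsPreconnected (L.lattice : Set ℂ)ᶜ :=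
  (L.countable_lattice.isConnected_compl_of_one_lt_rank
    (by rw [Complex.rank_real_complex]; exact Cardinal.one_lt_two)).isPreconnected

/-- At a lattice point `℘` has no analytic continuation. -/
theorem not_eventuallyEq_of_analyticAt {l : ℂ} (hl : l ∈ L.lattice) {f : ℂ → ℂ}
    (hf : AnalyticAt ℂ f l) : ¬ ℘[L] =ᶠ[𝓝[≠] l] f := by
  intro h
  have h1 := meromorphicOrderAt_congr h
  rw [L.order_weierstrassP l hl] at h1
  have h2 := hf.meromorphicOrderAt_nonneg
  rw [← h1] at h2
  exact absurd h2 (by decide)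

theorem hasDerivAt_weierstrassP {z : ℂ} (hz : z ∉ L.lattice) :
    HasDerivAt ℘[L] (℘'[L] z) z := by
  have h := (L.analyticOnNhd_weierstrassP z hz).differentiableAt.hasDerivAt
  rwa [L.deriv_weierstrassP] at h

/-- Otherwise `℘` would be constant off the lattice, contradicting its pole at `0`. This permits
cancelling `℘'` in analytic identities. -/
theorem not_forall_derivWeierstrassP_eq_zero : ¬ ∀ z ∈ (L.lattice : Set ℂ)ᶜ, ℘'[L] z = 0 := by
  intro h
  obtain ⟨c, hc⟩ := L.isClosed_lattice.isOpen_compl.exists_is_const_of_deriv_eq_zero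
    L.isPreconnected_compl_lattice L.differentiableOn_weierstrassP
    (fun z hz => by rw [L.deriv_weierstrassP]; exact h z hz)
  refine L.not_eventuallyEq_of_analyticAt L.lattice.zero_mem (analyticAt_const (v := c)) ?_
  filter_upwards [self_mem_nhdsWithin, mem_nhdsWithin_of_mem_nhds
    (L.compl_lattice_sdiff_singleton_mem_nhds 0)] with z hz hz'
  exact hc z (by simp_all)

/-- `℘'' = 6 ℘² - g₂ / 2`. -/
theorem hasDerivAt_derivWeierstrassP {z : ℂ} (hz : z ∉ L.lattice) :
    HasDerivAt ℘'[L] (6 * ℘[L] z ^ 2 - L.g₂ / 2) z := by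
  have hA := L.analyticOnNhd_derivWeierstrassP
  have hP := L.analyticOnNhd_weierstrassP
  have hF : AnalyticOnNhd ℂ (fun z => deriv ℘'[L] z - (6 * ℘[L] z ^ 2 - L.g₂ / 2))
      (L.lattice : Set ℂ)ᶜ := fun z hz => by
    have := hP z hz
    have := (hA z hz).deriv
    fun_prop
  -- Differentiating `℘'² = 4 ℘³ - g₂ ℘ - g₃` gives the desired equation multiplied by `℘'`.
  have hmul : ∀ z ∈ (L.lattice : Set ℂ)ᶜ,
      ℘'[L] z * (deriv ℘'[L] z - (6 * ℘[L] z ^ 2 - L.g₂ / 2)) = 0 := by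
    intro z hz
    have h1 := ((hA z hz).differentiableAt.hasDerivAt).pow 2
    have h0 := L.hasDerivAt_weierstrassP hz
    have h2 : HasDerivAt (fun z => 4 * ℘[L] z ^ 3 - L.g₂ * ℘[L] z - L.g₃)
        (4 * (3 * ℘[L] z ^ 2 * ℘'[L] z) - L.g₂ * ℘'[L] z) z := by
      have := (((h0.pow 3).const_mul 4).sub (h0.const_mul L.g₂)).sub_const L.g₃
      simpa using this
    have h3 : (℘'[L] ^ 2) =ᶠ[𝓝 z] fun z => 4 * ℘[L] z ^ 3 - L.g₂ * ℘[L] z - L.g₃ := by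
      filter_upwards [L.isClosed_lattice.isOpen_compl.mem_nhds hz] with y hy
      exact L.derivWeierstrassP_sq y hy
    have h4 := h1.unique (h2.congr_of_eventuallyEq h3)
    simp at h4
    linear_combination h4 / 2
  have h := (hA.eq_zero_or_eq_zero_of_mul_eq_zero hF hmul
    L.isPreconnected_compl_lattice).resolve_left L.not_forall_derivWeierstrassP_eq_zero z hz
  have h1 := (hA z hz).differentiableAt.hasDerivAt
  rwa [sub_eq_zero.1 h] at h1

/-- The zeros of `℘'` are half-periods. -/
theorem two_mul_mem_lattice {z₀ : ℂ} (hz₀ : z₀ ∉ L.lattice) (h0 : ℘'[L] z₀ = 0) :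
    2 * z₀ ∈ L.lattice := by
  by_contra h2
  have hP := L.analyticOnNhd_weierstrassP
  set V : Set ℂ := {s | z₀ + s ∉ L.lattice ∧ z₀ - s ∉ L.lattice} with hV
  have hVc : Vᶜ ⊆ (fun l => l - z₀) '' (L.lattice : Set ℂ) ∪
      (fun l => z₀ - l) '' (L.lattice : Set ℂ) := by
    intro s hs
    rw [hV, Set.mem_compl_iff, Set.mem_ofPred_eq, not_and_or, not_not, not_not] at hs
    rcases hs with hs | hs
    · exact Or.inl ⟨_, hs, by ring⟩
    · exact Or.inr ⟨_, hs, by ring⟩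
  have hVpre : IsPreconnected V := by
    have := (((L.countable_lattice.image _).union (L.countable_lattice.image _)).mono
      hVc).isConnected_compl_of_one_lt_rank
      (by rw [Complex.rank_real_complex]; exact Cardinal.one_lt_two)
    rw [compl_compl] at this
    exact this.isPreconnected
  have hVo : IsOpen V := by
    have hc := L.isClosed_lattice.isOpen_compl
    exact (hc.preimage (f := fun s : ℂ => z₀ + s) (by fun_prop)).inter
      (hc.preimage (f := fun s : ℂ => z₀ - s) (by fun_prop))
  have h0V : (0 : ℂ) ∈ V := by simp [hV, hz₀]
  -- This odd part of `℘` about `z₀` satisfies `u'' = 6 (℘(z₀ + s) + ℘(z₀ - s)) u` with `u(0) =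
  -- u'(0) = 0`, so it should vanish identically.
  set u : ℂ → ℂ := fun s => ℘[L] (z₀ + s) - ℘[L] (z₀ - s) with hu
  have hua : AnalyticOnNhd ℂ u V := by
    intro s hs
    exact ((hP _ hs.1).fun_comp (f := fun s => z₀ + s) (by fun_prop)).sub
      ((hP _ hs.2).fun_comp (f := fun s => z₀ - s) (by fun_prop))
  have hca : AnalyticOnNhd ℂ (fun s => 6 * (℘[L] (z₀ + s) + ℘[L] (z₀ - s))) V := by
    intro s hs
    exact analyticAt_const.mul (((hP _ hs.1).fun_comp (f := fun s => z₀ + s) (by fun_prop)).add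
      ((hP _ hs.2).fun_comp (f := fun s => z₀ - s) (by fun_prop)))
  have hd1 : ∀ s ∈ V, deriv u s = ℘'[L] (z₀ + s) + ℘'[L] (z₀ - s) := by
    intro s hs
    have e1 := (L.hasDerivAt_weierstrassP hs.1).comp_const_add z₀ s
    have e2 := (L.hasDerivAt_weierstrassP hs.2).comp_const_sub z₀ s
    exact (e1.sub e2).deriv.trans (by ring)
  have hd2 : ∀ s ∈ V, deriv (deriv u) s = 6 * (℘[L] (z₀ + s) + ℘[L] (z₀ - s)) * u s := by
    intro s hs
    have e1 := (L.hasDerivAt_derivWeierstrassP hs.1).comp_const_add z₀ s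
    have e2 := (L.hasDerivAt_derivWeierstrassP hs.2).comp_const_sub z₀ s
    have e3 : deriv u =ᶠ[𝓝 s] fun s => ℘'[L] (z₀ + s) + ℘'[L] (z₀ - s) := by
      filter_upwards [hVo.mem_nhds hs] with t ht
      exact hd1 t ht
    rw [e3.deriv_eq]
    exact (e1.add e2).deriv.trans (by simp only [hu]; ring)
  have hu0 : u 0 = 0 := by simp [hu]
  have hu1 : deriv u 0 = 0 := by rw [hd1 0 h0V]; simp [h0]
  have o1 := (hua 0 h0V).analyticOrderAt_deriv_add_one
  have o2 := (hua 0 h0V).deriv.analyticOrderAt_deriv_add_one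
  simp only [hu0, hu1, sub_zero] at o1 o2
  have e3 : deriv (deriv u) =ᶠ[𝓝 0] (fun s => 6 * (℘[L] (z₀ + s) + ℘[L] (z₀ - s))) * u := by
    filter_upwards [hVo.mem_nhds h0V] with t ht
    exact hd2 t ht
  rw [analyticOrderAt_congr e3, analyticOrderAt_mul (hca 0 h0V) (hua 0 h0V)] at o2
  -- The equation `u'' = c u` gives `ord u = ord c + ord u + 2`, impossible for finite order; no
  -- existence or uniqueness theory is needed.
  have otop : analyticOrderAt u 0 = ⊤ := by
    have o1' : analyticOrderAt (deriv u) 0 + 1 = analyticOrderAt u 0 := o1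
    have o2' : _ + analyticOrderAt u 0 + 1 = analyticOrderAt (deriv u) 0 := o2
    rw [← o2'] at o1'
    generalize analyticOrderAt u 0 = N at o1'
    generalize analyticOrderAt (fun s => 6 * (℘[L] (z₀ + s) + ℘[L] (z₀ - s))) 0 = M at o1'
    cases N with
    | top => rfl
    | coe N =>
      cases M with
      | top => simp at o1'
      | coe M =>
        norm_cast at o1'
        omega
  have hall := hua.eqOn_zero_of_preconnected_of_eventuallyEq_zero hVpre h0V
    (analyticOrderAt_eq_top.1 otop)
  -- Taking `s = z₀ - t` gives `℘(t) = ℘(2 z₀ - t)`, whose right side is regular at the pole `t =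
  -- 0`.
  refine L.not_eventuallyEq_of_analyticAt L.lattice.zero_mem (f := fun t => ℘[L] (2 * z₀ - t)) ?_ ?_
  · exact (hP (2 * z₀ - 0) (by simpa using h2)).fun_comp (f := fun t => 2 * z₀ - t) (by fun_prop)
  · have hc : ∀ᶠ t in 𝓝 (0 : ℂ), 2 * z₀ - t ∉ L.lattice := by
      have := L.isClosed_lattice.isOpen_compl.preimage (f := fun t : ℂ => 2 * z₀ - t) (by fun_prop)
      exact this.mem_nhds (by simpa using h2)
    filter_upwards [self_mem_nhdsWithin, mem_nhdsWithin_of_mem_nhds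
      (L.compl_lattice_sdiff_singleton_mem_nhds 0), mem_nhdsWithin_of_mem_nhds hc] with t ht ht' ht2
    have htL : t ∉ L.lattice := by simp_all
    have hs : z₀ - t ∈ V := by
      refine ⟨?_, by simpa using htL⟩
      rwa [show z₀ + (z₀ - t) = 2 * z₀ - t by ring]
    have h3 : ℘[L] (z₀ + (z₀ - t)) - ℘[L] (z₀ - (z₀ - t)) = 0 := hall hs
    rw [show z₀ + (z₀ - t) = 2 * z₀ - t by ring, sub_sub_cancel] at h3
    exact (sub_eq_zero.1 h3).symm

theorem weierstrassP_conj (h : ∀ l ∈ L.lattice, (starRingEnd ℂ) l ∈ L.lattice) (z : ℂ) :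
    ℘[L] ((starRingEnd ℂ) z) = (starRingEnd ℂ) (℘[L] z) := by
  let e : L.lattice ≃ L.lattice :=
    { toFun := fun l => ⟨_, h l l.2⟩
      invFun := fun l => ⟨_, h l l.2⟩
      left_inv := fun l => Subtype.ext (by simp)
      right_inv := fun l => Subtype.ext (by simp) }
  rw [weierstrassP, weierstrassP, Complex.conj_tsum, ← e.tsum_eq]
  refine tsum_congr fun l => ?_
  simp [e]

/-- `℘'` vanishes at half-periods. -/
theorem derivWeierstrassP_eq_zero {z : ℂ} (hz : 2 * z ∈ L.lattice) : ℘'[L] z = 0 := by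
  have h1 := L.derivWeierstrassP_add_coe (-z) ⟨_, hz⟩
  rw [show -z + ((⟨2 * z, hz⟩ : L.lattice) : ℂ) = z by simp; ring, derivWeierstrassP_neg] at h1
  exact self_eq_neg.1 h1

/-- Two half-periods with different values of `℘` determine `℘''` there. -/
theorem deriv_derivWeierstrassP_of_half_periods {z z' : ℂ} (hz : 2 * z ∈ L.lattice)
    (hz' : 2 * z' ∈ L.lattice) (hzn : z ∉ L.lattice) (hzn' : z' ∉ L.lattice)
    (hne : ℘[L] z ≠ ℘[L] z') :
    deriv ℘'[L] z = 2 * (℘[L] z - ℘[L] z') * (2 * ℘[L] z + ℘[L] z') := by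
  have h1 := L.derivWeierstrassP_sq z hzn
  have h2 := L.derivWeierstrassP_sq z' hzn'
  rw [L.derivWeierstrassP_eq_zero hz] at h1
  rw [L.derivWeierstrassP_eq_zero hz'] at h2
  -- The cubic `4 X³ - g₂ X - g₃` vanishes at both values; subtracting and cancelling their
  -- difference eliminates `g₃`.
  have h3 : L.g₂ = 4 * (℘[L] z ^ 2 + ℘[L] z * ℘[L] z' + ℘[L] z' ^ 2) :=
    mul_left_cancel₀ (sub_ne_zero.2 hne) (by linear_combination h1 - h2)
  rw [(L.hasDerivAt_derivWeierstrassP hzn).deriv, h3]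
  ring

end PeriodPair

/-! ### Listing zeros of compositions -/

theorem realPolyFun_prod (N : ℕ) (x : ℕ → ℝ) (z : ℂ) :
    realPolyFun (∏ i ∈ Finset.range N, (X - C (x i))) z =
      ∏ i ∈ Finset.range N, (z - (x i : ℂ)) := by
  simp [realPolyFun, map_prod]

/-- By injectivity `f - x i` vanishes on `γ` only at `z i`, and simply since the derivative is
nonzero there; the orders of the factors add. -/
theorem analyticOrderAt_prod_sub {f : ℂ → ℂ} {γ : Set ℂ} (hf : AnalyticOnNhd ℂ f γ)
    (hinj : Set.InjOn f γ) {ζ : ℂ} (hζ : ζ ∈ γ) {x : ℕ → ℝ} {z : ℕ → ℂ} (s : Finset ℕ)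
    (hz : ∀ i ∈ s, z i ∈ γ) (hfz : ∀ i ∈ s, f (z i) = x i) (hd : ∀ i ∈ s, deriv f (z i) ≠ 0) :
    analyticOrderAt (fun y => ∏ i ∈ s, (f y - (x i : ℂ))) ζ =
      ((s.filter (fun i => z i = ζ)).card : ℕ∞) := by
  classical
  induction s using Finset.induction_on with
  | empty => simp [analyticOrderAt_eq_zero]
  | insert i s hi ih =>
    have ih := ih (fun j hj => hz j (Finset.mem_insert_of_mem hj))
      (fun j hj => hfz j (Finset.mem_insert_of_mem hj))
      (fun j hj => hd j (Finset.mem_insert_of_mem hj))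
    have hfa : AnalyticAt ℂ f ζ := hf ζ hζ
    have h1 : AnalyticAt ℂ (fun y => f y - (x i : ℂ)) ζ := by fun_prop
    have h2 : AnalyticAt ℂ (fun y => ∏ i ∈ s, (f y - (x i : ℂ))) ζ :=
      Finset.analyticAt_fun_prod _ fun j _ => by fun_prop
    have h3 : (fun y => ∏ j ∈ insert i s, (f y - (x j : ℂ))) =
        (fun y => f y - (x i : ℂ)) * fun y => ∏ i ∈ s, (f y - (x i : ℂ)) := by
      ext y
      rw [Finset.prod_insert hi, Pi.mul_apply]
    rw [h3, analyticOrderAt_mul h1 h2, ih, Finset.filter_insert]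
    have hi' := Finset.mem_insert_self i s
    split_ifs with h
    · have h4 : analyticOrderAt (fun y => f y - (x i : ℂ)) ζ = 1 := by
        rw [← hfz i hi', h]
        exact hfa.analyticOrderAt_sub_eq_one_of_deriv_ne_zero (h ▸ hd i hi')
      rw [h4, Finset.card_insert_of_notMem (by simp [hi]), add_comm]
      push_cast
      rfl
    · have h4 : analyticOrderAt (fun y => f y - (x i : ℂ)) ζ = 0 := by
        rw [h1.analyticOrderAt_eq_zero, ← hfz i hi', sub_ne_zero]
        exact fun h5 => h (hinj (hz i hi') hζ h5.symm)
      rw [h4, zero_add]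

theorem listsZeros_comp {P : ℝ[X]} {a b : ℝ} {N : ℕ} {x : ℕ → ℝ} (hP : HasSortedZeros P a b N x)
    {f : ℂ → ℂ} {γ : Set ℂ} {z : ℕ → ℂ} (hf : AnalyticOnNhd ℂ f γ) (hinj : Set.InjOn f γ)
    (hz : ∀ i < N, z i ∈ γ) (hfz : ∀ i < N, f (z i) = x i) (hd : ∀ i < N, deriv f (z i) ≠ 0) :
    ListsZeros (fun y => realPolyFun P (f y)) γ N z := by
  simp only [hP.eq_prod, realPolyFun_prod]
  refine ⟨fun ζ hζ => Finset.analyticAt_fun_prod _ fun j _ => (hf ζ hζ).sub analyticAt_const, hz,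
    fun ζ hζ => analyticOrderAt_prod_sub hf hinj hζ _ ?_ ?_ ?_⟩
  · exact fun i hi => hz i (Finset.mem_range.1 hi)
  · exact fun i hi => hfz i (Finset.mem_range.1 hi)
  · exact fun i hi => hd i (Finset.mem_range.1 hi)

theorem ListsZeros.mul_of_ne_zero {F g : ℂ → ℂ} {γ : Set ℂ} {N : ℕ} {z : ℕ → ℂ}
    (hF : ListsZeros F γ N z) (hg : AnalyticOnNhd ℂ g γ) (h0 : ∀ ζ ∈ γ, g ζ ≠ 0) :
    ListsZeros (fun y => g y * F y) γ N z := by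
  refine ⟨fun ζ hζ => (hg ζ hζ).mul (hF.analytic ζ hζ), hF.mem, fun ζ hζ => ?_⟩
  have := analyticOrderAt_mul (hg ζ hζ) (hF.analytic ζ hζ)
  rw [(hg ζ hζ).analyticOrderAt_eq_zero.2 (h0 ζ hζ), zero_add, hF.mult ζ hζ] at this
  exact this

/-- Adds a first and a last term to the list `z 0, …, z (N - 1)`. -/
def addEnds (A B : ℂ) (N : ℕ) (z : ℕ → ℂ) (i : ℕ) : ℂ :=
  if i = 0 then A else if i ≤ N then z (i - 1) else B

theorem addEnds_zero (A B : ℂ) (N : ℕ) (z : ℕ → ℂ) : addEnds A B N z 0 = A := by simp [addEnds]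

theorem addEnds_succ (A B : ℂ) {N : ℕ} (z : ℕ → ℂ) {i : ℕ} (hi : i < N) :
    addEnds A B N z (i + 1) = z i := by
  simp [addEnds, Nat.succ_le_iff.2 hi]

theorem addEnds_last (A B : ℂ) (N : ℕ) (z : ℕ → ℂ) : addEnds A B N z (N + 1) = B := by
  simp [addEnds]

theorem ListsZeros.mul_of_simple_ends {F g : ℂ → ℂ} {γ : Set ℂ} {N : ℕ} {z : ℕ → ℂ} {A B : ℂ}
    (hF : ListsZeros F γ N z) (hg : AnalyticOnNhd ℂ g γ) (hA : A ∈ γ) (hB : B ∈ γ) (hAB : A ≠ B)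
    (gA : analyticOrderAt g A = 1) (gB : analyticOrderAt g B = 1)
    (h0 : ∀ ζ ∈ γ, ζ ≠ A → ζ ≠ B → g ζ ≠ 0) :
    ListsZeros (fun y => g y * F y) γ (N + 2) (addEnds A B N z) := by
  classical
  refine ⟨fun ζ hζ => (hg ζ hζ).mul (hF.analytic ζ hζ), fun i hi => ?_, fun ζ hζ => ?_⟩
  · rcases i with _ | i
    · rwa [addEnds_zero]
    · rcases (show i ≤ N by omega).eq_or_lt with rfl | h
      · rwa [addEnds_last]
      · rw [addEnds_succ _ _ _ h]
        exact hF.mem i h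
  · have h1 : analyticOrderAt (fun y => g y * F y) ζ = _ :=
      analyticOrderAt_mul (hg ζ hζ) (hF.analytic ζ hζ)
    have h2 : analyticOrderAt g ζ = (((if A = ζ then 1 else 0) + (if B = ζ then 1 else 0) : ℕ) :
        ℕ∞) := by
      by_cases hζA : A = ζ
      · subst hζA
        simp [hAB.symm, gA]
      · by_cases hζB : B = ζ
        · subst hζB
          simp [hAB, gB]
        · simp only [hζA, hζB, if_false]
          exact (hg ζ hζ).analyticOrderAt_eq_zero.2 (h0 ζ hζ (Ne.symm hζA) (Ne.symm hζB))
    rw [h1, h2, hF.mult ζ hζ, ← Nat.cast_add]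
    congr 1
    -- Splitting off the last and first indices isolates the contributions of `B` and `A`.
    rw [Finset.card_filter, Finset.card_filter, Finset.sum_range_succ, addEnds_last,
      Finset.sum_range_succ', addEnds_zero]
    have : ∑ k ∈ Finset.range N, (if addEnds A B N z (k + 1) = ζ then 1 else 0) =
        ∑ k ∈ Finset.range N, if z k = ζ then 1 else 0 :=
      Finset.sum_congr rfl fun k hk => by rw [addEnds_succ _ _ _ (Finset.mem_range.1 hk)]
    rw [this]
    ring

/-! ### The Weierstrass function on the half contour -/

section Contour

variable {ω₁ τ : ℝ} (hω : 0 < ω₁) (hτ : 0 < τ)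

theorem mem_lattice_rectPeriods {z : ℂ} : z ∈ (rectPeriods ω₁ τ hω hτ).lattice ↔
    ∃ m n : ℤ, z.re = m * (2 * ω₁) ∧ z.im = n * (2 * τ) := by
  rw [PeriodPair.mem_lattice]
  refine exists_congr fun m => exists_congr fun n => ?_
  rw [Complex.ext_iff]
  simp [rectPeriods, eq_comm]

theorem contour_notMem_lattice (t : ℝ) :
    (τ * I + t * ω₁ : ℂ) ∉ (rectPeriods ω₁ τ hω hτ).lattice := by
  rw [mem_lattice_rectPeriods]
  rintro ⟨m, n, -, h⟩
  simp at h
  have h1 : (1 : ℝ) = ((n * 2 : ℤ) : ℝ) := by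
    push_cast
    exact mul_right_cancel₀ hτ.ne' (by linear_combination h)
  have h2 : (1 : ℤ) = n * 2 := by exact_mod_cast h1
  omega

theorem contour_left_two_mul_mem : 2 * (τ * I : ℂ) ∈ (rectPeriods ω₁ τ hω hτ).lattice := by
  rw [mem_lattice_rectPeriods]
  exact ⟨0, 1, by simp, by simp⟩

theorem contour_right_two_mul_mem : 2 * (ω₁ + τ * I : ℂ) ∈ (rectPeriods ω₁ τ hω hτ).lattice := by
  rw [mem_lattice_rectPeriods]
  exact ⟨1, 1, by simp, by simp⟩

/-- Conjugation commutes with `℘` and moves a contour point by the period `2 i τ`. -/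
theorem weierstrassP_contour_im (t : ℝ) :
    (℘[rectPeriods ω₁ τ hω hτ] (τ * I + t * ω₁)).im = 0 := by
  have hc := (rectPeriods ω₁ τ hω hτ).weierstrassP_conj (fun l hl => by
    rw [mem_lattice_rectPeriods] at hl ⊢
    obtain ⟨m, n, h1, h2⟩ := hl
    exact ⟨m, -n, by simpa using h1, by simp [h2]⟩) (τ * I + t * ω₁)
  have h2 := (rectPeriods ω₁ τ hω hτ).weierstrassP_add_coe
    ((starRingEnd ℂ) (τ * I + t * ω₁)) ⟨_, contour_left_two_mul_mem hω hτ⟩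
  rw [show (starRingEnd ℂ) (τ * I + t * ω₁ : ℂ) +
    ((⟨_, contour_left_two_mul_mem hω hτ⟩ : (rectPeriods ω₁ τ hω hτ).lattice) : ℂ) =
      τ * I + t * ω₁ by simp; ring, hc] at h2
  exact Complex.conj_eq_iff_im.1 h2.symm

/-- A critical point would be a half-period, which forces `t` to be an integer. -/
theorem derivWeierstrassP_contour_ne_zero {t : ℝ} (ht : t ∈ Set.Ioo (0 : ℝ) 1) :
    ℘'[rectPeriods ω₁ τ hω hτ] (τ * I + t * ω₁) ≠ 0 := by
  intro h
  have h1 := PeriodPair.two_mul_mem_lattice _ (contour_notMem_lattice hω hτ t) h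
  rw [mem_lattice_rectPeriods] at h1
  obtain ⟨m, -, h2, -⟩ := h1
  simp at h2
  have h3 : t = m := mul_right_cancel₀ (mul_pos two_pos hω).ne' (by linear_combination h2)
  rw [h3] at ht
  have h4 : 0 < m := by exact_mod_cast ht.1
  have h5 : m < 1 := by exact_mod_cast ht.2
  omega

theorem hasDerivAt_weierstrassP_contour (t : ℝ) :
    HasDerivAt (fun t : ℝ => ℘[rectPeriods ω₁ τ hω hτ] (τ * I + t * ω₁))
      (℘'[rectPeriods ω₁ τ hω hτ] (τ * I + t * ω₁) * ω₁) t := by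
  have h1 := (rectPeriods ω₁ τ hω hτ).hasDerivAt_weierstrassP (contour_notMem_lattice hω hτ t)
  have h2 : HasDerivAt (fun t : ℝ => (τ * I + t * ω₁ : ℂ)) (1 * ω₁ : ℂ) t :=
    ((Complex.ofRealCLM.hasDerivAt (x := t)).mul_const (ω₁ : ℂ)).const_add (τ * I : ℂ)
  rw [one_mul] at h2
  exact h1.comp t h2

/-- By Rolle a repeated value would give an interior zero of `℘'`. A continuous injective function
is monotone, and `e₃ < e₂` fixes the direction. -/
theorem strictMonoOn_weierstrassP_contour {e₂ e₃ : ℝ} (h32 : e₃ < e₂)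
    (hr : ℘[rectPeriods ω₁ τ hω hτ] ((ω₁ : ℂ) + (τ : ℂ) * Complex.I) = (e₂ : ℂ))
    (hl : ℘[rectPeriods ω₁ τ hω hτ] ((τ : ℂ) * Complex.I) = (e₃ : ℂ)) :
    StrictMonoOn (fun t : ℝ => (℘[rectPeriods ω₁ τ hω hτ] (τ * I + t * ω₁)).re)
      (Set.Icc 0 1) := by
  set f : ℝ → ℂ := fun t => ℘[rectPeriods ω₁ τ hω hτ] (τ * I + t * ω₁) with hf
  have hd : ∀ t : ℝ, HasDerivAt f (℘'[rectPeriods ω₁ τ hω hτ] (τ * I + t * ω₁) * ω₁) t :=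
    hasDerivAt_weierstrassP_contour hω hτ
  have hre : ∀ t : ℝ, HasDerivAt (fun t => (f t).re)
      (℘'[rectPeriods ω₁ τ hω hτ] (τ * I + t * ω₁) * ω₁).re t := fun t =>
    Complex.reCLM.hasFDerivAt.comp_hasDerivAt t (hd t)
  have him : ∀ t : ℝ, HasDerivAt (fun t => (f t).im)
      (℘'[rectPeriods ω₁ τ hω hτ] (τ * I + t * ω₁) * ω₁).im t := fun t =>
    Complex.imCLM.hasFDerivAt.comp_hasDerivAt t (hd t)
  have him0 : ∀ t : ℝ, (℘'[rectPeriods ω₁ τ hω hτ] (τ * I + t * ω₁) * ω₁).im = 0 := by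
    intro t
    have h1 : (fun t => (f t).im) = fun _ => 0 := funext (weierstrassP_contour_im hω hτ)
    have h2 := him t
    rw [h1] at h2
    exact h2.unique (hasDerivAt_const t 0)
  have hcont : Continuous fun t => (f t).re :=
    continuous_iff_continuousAt.2 fun t => (hre t).continuousAt
  have hinj : Set.InjOn (fun t => (f t).re) (Set.Icc 0 1) := by
    intro s hs t ht hst
    by_contra hne
    wlog hlt : s < t generalizing s t
    · exact this ht hs hst.symm (Ne.symm hne) (lt_of_le_of_ne (not_lt.1 hlt) (Ne.symm hne))
    obtain ⟨c, hc, hc0⟩ := exists_hasDerivAt_eq_zero hlt hcont.continuousOn hst fun x _ => hre x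
    have h0 := Complex.ext (z := ℘'[rectPeriods ω₁ τ hω hτ] (τ * I + c * ω₁) * ω₁) (w := 0)
      hc0 (him0 c)
    refine derivWeierstrassP_contour_ne_zero hω hτ (t := c)
      ⟨hs.1.trans_lt hc.1, hc.2.trans_le ht.2⟩ ?_
    exact (mul_eq_zero.1 h0).resolve_right (by exact_mod_cast hω.ne')
  refine ContinuousOn.strictMonoOn_of_injOn_Icc zero_le_one ?_ hcont.continuousOn hinj
  have h0 : f 0 = e₃ := by simpa [hf] using hl
  have h1 : f 1 = e₂ := by simpa [hf, add_comm] using hr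
  have h2 : (f 0).re ≤ (f 1).re := by
    rw [h0, h1, Complex.ofReal_re, Complex.ofReal_re]
    exact h32.le
  exact h2

end Contour

/-! ### Lifting zeros through `℘` to the half contour -/

section Contour

variable {ω₁ τ : ℝ} (hω : 0 < ω₁) (hτ : 0 < τ)

theorem openHalfContour_subset (ω₁ τ : ℝ) : openHalfContour ω₁ τ ⊆ halfContour ω₁ τ :=
  Set.image_mono Set.Ioo_subset_Icc_self

theorem notMem_lattice_of_mem_halfContour {z : ℂ} (hz : z ∈ halfContour ω₁ τ) :
    z ∉ (rectPeriods ω₁ τ hω hτ).lattice := by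
  obtain ⟨t, -, rfl⟩ := hz
  exact contour_notMem_lattice hω hτ t

theorem analyticOnNhd_weierstrassP_halfContour :
    AnalyticOnNhd ℂ ℘[rectPeriods ω₁ τ hω hτ] (halfContour ω₁ τ) := fun z hz =>
  (rectPeriods ω₁ τ hω hτ).analyticOnNhd_weierstrassP z
    (notMem_lattice_of_mem_halfContour hω hτ hz)

variable {e₂ e₃ : ℝ} (h32 : e₃ < e₂)
  (hr : ℘[rectPeriods ω₁ τ hω hτ] ((ω₁ : ℂ) + (τ : ℂ) * Complex.I) = (e₂ : ℂ))
  (hl : ℘[rectPeriods ω₁ τ hω hτ] ((τ : ℂ) * Complex.I) = (e₃ : ℂ))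

include h32 hr hl

theorem injOn_weierstrassP_halfContour :
    Set.InjOn ℘[rectPeriods ω₁ τ hω hτ] (halfContour ω₁ τ) := by
  rintro _ ⟨s, hs, rfl⟩ _ ⟨t, ht, rfl⟩ hst
  rw [(strictMonoOn_weierstrassP_contour hω hτ h32 hr hl).injOn hs ht (congrArg Complex.re hst)]

/-- On the half contour the values of `℘` are real numbers in `[e₃, e₂]`. -/
theorem exists_weierstrassP_eq_of_mem_halfContour {z : ℂ} (hz : z ∈ halfContour ω₁ τ) :
    ∃ v ∈ Set.Icc e₃ e₂, ℘[rectPeriods ω₁ τ hω hτ] z = (v : ℂ) := by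
  obtain ⟨t, ht, rfl⟩ := hz
  have hmono := (strictMonoOn_weierstrassP_contour hω hτ h32 hr hl).monotoneOn
  have h0 := hmono (Set.left_mem_Icc.2 zero_le_one) ht ht.1
  have h1 := hmono ht (Set.right_mem_Icc.2 zero_le_one) ht.2
  simp only [Complex.ofReal_zero, zero_mul, add_zero, hl, Complex.ofReal_re] at h0
  simp only [Complex.ofReal_one, one_mul, add_comm (τ * I : ℂ) (ω₁ : ℂ), hr,
    Complex.ofReal_re] at h1
  exact ⟨_, ⟨h0, h1⟩, Complex.ext rfl (weierstrassP_contour_im hω hτ t)⟩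

/-- The inverse of `℘` on the half contour. -/
theorem exists_inverse_weierstrassP_contour : ∃ T : ℝ → ℝ,
    (∀ v ∈ Set.Ioo e₃ e₂, T v ∈ Set.Ioo (0 : ℝ) 1 ∧
      ℘[rectPeriods ω₁ τ hω hτ] (τ * I + T v * ω₁) = (v : ℂ)) ∧
    StrictMonoOn T (Set.Ioo e₃ e₂) := by
  have hmono := strictMonoOn_weierstrassP_contour hω hτ h32 hr hl
  set f : ℝ → ℝ := fun t => (℘[rectPeriods ω₁ τ hω hτ] (τ * I + t * ω₁)).re with hf
  have hcont : Continuous f := continuous_iff_continuousAt.2 fun t =>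
    Complex.continuous_re.continuousAt.comp
      (hasDerivAt_weierstrassP_contour hω hτ t).continuousAt
  have h0 : f 0 = e₃ := by simp [hf, hl]
  have h1 : f 1 = e₂ := by simp [hf, add_comm (τ * I : ℂ) (ω₁ : ℂ), hr]
  have hex : ∀ v, ∃ t, v ∈ Set.Ioo e₃ e₂ → t ∈ Set.Ioo (0 : ℝ) 1 ∧ f t = v := by
    intro v
    by_cases hv : v ∈ Set.Ioo e₃ e₂
    · rw [← h0, ← h1] at hv
      obtain ⟨t, ht, htv⟩ := intermediate_value_Ioo zero_le_one hcont.continuousOn hv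
      exact ⟨t, fun _ => ⟨ht, htv⟩⟩
    · exact ⟨0, fun h => absurd h hv⟩
  choose T hT using hex
  refine ⟨T, fun v hv => ⟨(hT v hv).1, Complex.ext (hT v hv).2 ?_⟩, fun u hu v hv huv => ?_⟩
  · simpa using weierstrassP_contour_im hω hτ (T v)
  · rw [← hmono.lt_iff_lt (Set.Ioo_subset_Icc_self (hT u hu).1)
      (Set.Ioo_subset_Icc_self (hT v hv).1)]
    exact ((hT u hu).2.trans_lt huv).trans_eq (hT v hv).2.symm

/-- The zeros of `P(℘)` on the half contour. -/
theorem listsZeros_comp_weierstrassP {T : ℝ → ℝ}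
    (hT : ∀ v ∈ Set.Ioo e₃ e₂, T v ∈ Set.Ioo (0 : ℝ) 1 ∧
      ℘[rectPeriods ω₁ τ hω hτ] (τ * I + T v * ω₁) = (v : ℂ))
    {P : ℝ[X]} {N : ℕ} {x : ℕ → ℝ} (hP : HasSortedZeros P e₃ e₂ N x) {γ : Set ℂ}
    (h1 : openHalfContour ω₁ τ ⊆ γ) (h2 : γ ⊆ halfContour ω₁ τ) :
    ListsZeros (fun z => realPolyFun P (℘[rectPeriods ω₁ τ hω hτ] z)) γ N
      (fun i => τ * I + T (x i) * ω₁) := by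
  -- The zeros of `P` are strictly inside `(e₃, e₂)`, so their lifts lie in the open contour and
  -- hence in every intermediate `γ`.
  refine listsZeros_comp hP ((analyticOnNhd_weierstrassP_halfContour hω hτ).mono h2)
    ((injOn_weierstrassP_halfContour hω hτ h32 hr hl).mono h2) (fun i hi => ?_) (fun i hi => ?_)
    (fun i hi => ?_)
  · exact h1 ⟨_, (hT _ (hP.mem i hi)).1, rfl⟩
  · exact (hT _ (hP.mem i hi)).2
  · rw [PeriodPair.deriv_weierstrassP]
    exact derivWeierstrassP_contour_ne_zero hω hτ (hT _ (hP.mem i hi)).1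

/-- Makes the zero of `℘'` at this end simple. When `e₁ = -e₂ - e₃`, the condition `h` reads `e₃ ≠
e₁`. -/
theorem deriv_derivWeierstrassP_left_ne_zero (h : 2 * e₃ + e₂ ≠ 0) :
    deriv ℘'[rectPeriods ω₁ τ hω hτ] (τ * I) ≠ 0 := by
  have n0 := contour_notMem_lattice hω hτ 0
  have n1 := contour_notMem_lattice hω hτ 1
  simp only [Complex.ofReal_zero, zero_mul, add_zero] at n0
  simp only [Complex.ofReal_one, one_mul, add_comm (τ * I : ℂ) (ω₁ : ℂ)] at n1
  rw [PeriodPair.deriv_derivWeierstrassP_of_half_periods _ (contour_left_two_mul_mem hω hτ)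
    (contour_right_two_mul_mem hω hτ) n0 n1 (by rw [hl, hr]; exact_mod_cast h32.ne), hl, hr]
  exact_mod_cast mul_ne_zero (mul_ne_zero two_ne_zero (sub_ne_zero.2 h32.ne)) h

theorem deriv_derivWeierstrassP_right_ne_zero (h : 2 * e₂ + e₃ ≠ 0) :
    deriv ℘'[rectPeriods ω₁ τ hω hτ] (ω₁ + τ * I) ≠ 0 := by
  have n0 := contour_notMem_lattice hω hτ 0
  have n1 := contour_notMem_lattice hω hτ 1
  simp only [Complex.ofReal_zero, zero_mul, add_zero] at n0
  simp only [Complex.ofReal_one, one_mul, add_comm (τ * I : ℂ) (ω₁ : ℂ)] at n1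
  rw [PeriodPair.deriv_derivWeierstrassP_of_half_periods _ (contour_right_two_mul_mem hω hτ)
    (contour_left_two_mul_mem hω hτ) n1 n0 (by rw [hl, hr]; exact_mod_cast h32.ne'), hl, hr]
  exact_mod_cast mul_ne_zero (mul_ne_zero two_ne_zero (sub_ne_zero.2 h32.ne')) h

end Contour

/-! ### The odd factor and the interlacing theorem -/

/-- The odd factor `-(1/2) ℘' / (℘ - e₁)` of the lifted functions. -/
noncomputable def oddFactor (L : PeriodPair) (e₁ : ℝ) (z : ℂ) : ℂ :=
  -(1 / 2) * (℘'[L] z / (℘[L] z - e₁))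

theorem liftedFun_even (L : PeriodPair) (e₁ e₂ e₃ : ℝ) (w : ℝ → ℝ) (j : ℕ) :
    liftedFun L e₁ e₂ e₃ w (2 * j) = fun z => realPolyFun (orthoPoly w e₃ e₂ j) (℘[L] z) := by
  funext z
  simp [liftedFun]

theorem liftedFun_odd (L : PeriodPair) (e₁ e₂ e₃ : ℝ) (w : ℝ → ℝ) (j : ℕ) :
    liftedFun L e₁ e₂ e₃ w (2 * j + 1) = fun z => oddFactor L e₁ z *
      realPolyFun (orthoPoly (modifiedWeight e₁ e₂ e₃ w) e₃ e₂ j) (℘[L] z) := by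
  funext z
  simp [liftedFun, oddFactor, show (2 * j + 1) / 2 = j by omega]

theorem analyticAt_oddFactor {L : PeriodPair} {e₁ : ℝ} {z : ℂ} (hz : z ∉ L.lattice)
    (h : ℘[L] z ≠ e₁) : AnalyticAt ℂ (oddFactor L e₁) z :=
  analyticAt_const.mul ((L.analyticOnNhd_derivWeierstrassP z hz).div
    ((L.analyticOnNhd_weierstrassP z hz).sub analyticAt_const) (sub_ne_zero.2 h))

theorem analyticOrderAt_oddFactor {L : PeriodPair} {e₁ : ℝ} {z : ℂ} (hz : z ∉ L.lattice)
    (h : ℘[L] z ≠ e₁) (h0 : ℘'[L] z = 0) (h1 : deriv ℘'[L] z ≠ 0) :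
    analyticOrderAt (oddFactor L e₁) z = 1 := by
  have hA := L.analyticOnNhd_derivWeierstrassP z hz
  have hB : AnalyticAt ℂ (fun z => -(1 / 2) * (℘[L] z - e₁)⁻¹) z :=
    analyticAt_const.mul (((L.analyticOnNhd_weierstrassP z hz).sub analyticAt_const).inv
      (sub_ne_zero.2 h))
  have he : oddFactor L e₁ = ℘'[L] * fun z => -(1 / 2) * (℘[L] z - e₁)⁻¹ := by
    funext z
    simp only [oddFactor, Pi.mul_apply]
    ring
  have hB0 : (fun z => -(1 / 2) * (℘[L] z - e₁)⁻¹) z ≠ 0 :=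
    mul_ne_zero (by norm_num) (inv_ne_zero (sub_ne_zero.2 h))
  rw [he, analyticOrderAt_mul hA hB, hA.analyticOrderAt_eq_one_of_zero_deriv_ne_zero h0 h1,
    hB.analyticOrderAt_eq_zero.2 hB0, add_zero]

theorem mainTheorem3 (e₁ e₂ e₃ : ℝ) (h₃ : e₃ < 0) (h₃₂ : e₃ < e₂) (h₂ : e₂ < |e₃| / 2)
    (h₁ : e₁ = -e₂ - e₃) (w : ℝ → ℝ) (hw : IsWeight w e₃ e₂) :
    (∀ (ω₁ τ : ℝ) (hω : 0 < ω₁) (hτ : 0 < τ),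
      ℘[rectPeriods ω₁ τ hω hτ] (ω₁ : ℂ) = (e₁ : ℂ) →
      ℘[rectPeriods ω₁ τ hω hτ] ((ω₁ : ℂ) + (τ : ℂ) * Complex.I) = (e₂ : ℂ) →
      ℘[rectPeriods ω₁ τ hω hτ] ((τ : ℂ) * Complex.I) = (e₃ : ℂ) →
      ∀ n : ℕ,
        StrictlyInterlaces (liftedFun (rectPeriods ω₁ τ hω hτ) e₁ e₂ e₃ w (n + 2))
          (liftedFun (rectPeriods ω₁ τ hω hτ) e₁ e₂ e₃ w n) (openHalfContour ω₁ τ) ∧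
        Interlaces (liftedFun (rectPeriods ω₁ τ hω hτ) e₁ e₂ e₃ w (n + 2))
          (liftedFun (rectPeriods ω₁ τ hω hτ) e₁ e₂ e₃ w n) (halfContour ω₁ τ) ∧
        (Even n →
          StrictlyInterlaces (liftedFun (rectPeriods ω₁ τ hω hτ) e₁ e₂ e₃ w (n + 2))
            (liftedFun (rectPeriods ω₁ τ hω hτ) e₁ e₂ e₃ w n) (halfContour ω₁ τ))) ∧
    (∀ n : ℕ, 1 ≤ n →
      StrictlyInterlaces (realPolyFun (orthoPoly w e₃ e₂ n))
        (realPolyFun (orthoPoly (modifiedWeight e₁ e₂ e₃ w) e₃ e₂ (n - 1)))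
        (realSegment e₃ e₂)) := by
  rw [abs_of_neg h₃] at h₂
  have h21 : e₂ < e₁ := by linarith
  have hw' := isWeight_modifiedWeight h21 hw
  refine ⟨?_, ?_⟩
  · intro ω₁ τ hω hτ _ hr hl n
    obtain ⟨T, hT, hTm⟩ := exists_inverse_weierstrassP_contour hω hτ h₃₂ hr hl
    have hre : ∀ v, (τ * I + T v * ω₁ : ℂ).re = T v * ω₁ := by simp
    have hlt : ∀ u ∈ Set.Ioo e₃ e₂, ∀ v ∈ Set.Ioo e₃ e₂, u < v →
        (τ * I + T u * ω₁ : ℂ).re < (τ * I + T v * ω₁ : ℂ).re := by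
      intro u hu v hv huv
      rw [hre, hre]
      exact mul_lt_mul_of_pos_right (hTm hu hv huv) hω
    have hsub := openHalfContour_subset ω₁ τ
    rcases Nat.even_or_odd' n with ⟨j, rfl | rfl⟩
    · obtain ⟨x, hx⟩ := exists_hasSortedZeros_orthoPoly h₃₂ hw (j + 1)
      obtain ⟨y, hy⟩ := exists_hasSortedZeros_orthoPoly h₃₂ hw j
      have hxy := interlacing_orthoPoly_succ h₃₂ hw hx hy
      -- For even indices no zero lies at an end, so one argument serves the open and the closed
      -- contour.
      have key : ∀ γ, openHalfContour ω₁ τ ⊆ γ → γ ⊆ halfContour ω₁ τ →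
          StrictlyInterlaces (liftedFun (rectPeriods ω₁ τ hω hτ) e₁ e₂ e₃ w (2 * j + 2))
            (liftedFun (rectPeriods ω₁ τ hω hτ) e₁ e₂ e₃ w (2 * j)) γ := by
        intro γ g1 g2
        rw [show 2 * j + 2 = 2 * (j + 1) by ring, liftedFun_even, liftedFun_even]
        refine ⟨j + 1, j, _, _, listsZeros_comp_weierstrassP hω hτ h₃₂ hr hl hT hx g1 g2,
          listsZeros_comp_weierstrassP hω hτ h₃₂ hr hl hT hy g1 g2, Or.inr rfl, ?_, ?_⟩
        · intro i hi
          exact hlt _ (hx.mem i (by omega)) _ (hy.mem i hi) (hxy i hi).1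
        · intro i hi
          exact hlt _ (hy.mem i (by omega)) _ (hx.mem _ hi) (hxy i (by omega)).2
      have hc := key _ hsub subset_rfl
      refine ⟨key _ subset_rfl hsub, ?_, fun _ => hc⟩
      obtain ⟨N, M, z, z', a1, a2, a3, a4, a5⟩ := hc
      exact ⟨N, M, z, z', a1, a2, a3, fun i hi => (a4 i hi).le, fun i hi => (a5 i hi).le⟩
    · obtain ⟨x, hx⟩ := exists_hasSortedZeros_orthoPoly h₃₂ hw' (j + 1)
      obtain ⟨y, hy⟩ := exists_hasSortedZeros_orthoPoly h₃₂ hw' j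
      have hxy := interlacing_orthoPoly_succ h₃₂ hw' hx hy
      have hx1 : ∀ i < j, _ := fun i hi => hlt _ (hx.mem i (by omega)) _ (hy.mem i hi) (hxy i hi).1
      have hx2 : ∀ i < j, _ := fun i hi =>
        hlt _ (hy.mem i hi) _ (hx.mem (i + 1) (by omega)) (hxy i hi).2
      set g := oddFactor (rectPeriods ω₁ τ hω hτ) e₁ with hgdef
      have hP1 : ∀ z ∈ halfContour ω₁ τ, ℘[rectPeriods ω₁ τ hω hτ] z ≠ e₁ := by
        intro z hz h
        obtain ⟨v, hv, hzv⟩ := exists_weierstrassP_eq_of_mem_halfContour hω hτ h₃₂ hr hl hz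
        rw [hzv] at h
        exact (hv.2.trans_lt h21).ne (by exact_mod_cast h)
      have hga : AnalyticOnNhd ℂ g (halfContour ω₁ τ) := fun z hz =>
        analyticAt_oddFactor (notMem_lattice_of_mem_halfContour hω hτ hz) (hP1 z hz)
      have hg0 : ∀ z ∈ openHalfContour ω₁ τ, g z ≠ 0 := by
        intro z hz
        refine mul_ne_zero (by norm_num) (div_ne_zero ?_ (sub_ne_zero.2 (hP1 z (hsub hz))))
        obtain ⟨t, ht, rfl⟩ := hz
        exact derivWeierstrassP_contour_ne_zero hω hτ ht
      rw [show 2 * j + 1 + 2 = 2 * (j + 1) + 1 by ring, liftedFun_odd, liftedFun_odd]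
      refine ⟨?_, ?_, fun h => absurd h (by simp)⟩
      · refine ⟨j + 1, j, _, _,
          (listsZeros_comp_weierstrassP hω hτ h₃₂ hr hl hT hx subset_rfl hsub).mul_of_ne_zero
            (hga.mono hsub) hg0,
          (listsZeros_comp_weierstrassP hω hτ h₃₂ hr hl hT hy subset_rfl hsub).mul_of_ne_zero
            (hga.mono hsub) hg0, Or.inr rfl, hx1, fun i hi => hx2 i (by omega)⟩
      · have hA : (τ * I : ℂ) ∈ halfContour ω₁ τ := ⟨0, Set.left_mem_Icc.2 zero_le_one, by simp⟩
        have hB : (ω₁ + τ * I : ℂ) ∈ halfContour ω₁ τ :=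
          ⟨1, Set.right_mem_Icc.2 zero_le_one, by simp [add_comm]⟩
        have hAB : (τ * I : ℂ) ≠ ω₁ + τ * I := by
          intro h
          have : (ω₁ : ℂ) = 0 := by linear_combination -h
          exact hω.ne' (by exact_mod_cast this)
        have gA : analyticOrderAt g (τ * I) = 1 := analyticOrderAt_oddFactor
          (notMem_lattice_of_mem_halfContour hω hτ hA) (hP1 _ hA)
          (PeriodPair.derivWeierstrassP_eq_zero _ (contour_left_two_mul_mem hω hτ))
          (deriv_derivWeierstrassP_left_ne_zero hω hτ h₃₂ hr hl (by linarith))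
        have gB : analyticOrderAt g (ω₁ + τ * I) = 1 := analyticOrderAt_oddFactor
          (notMem_lattice_of_mem_halfContour hω hτ hB) (hP1 _ hB)
          (PeriodPair.derivWeierstrassP_eq_zero _ (contour_right_two_mul_mem hω hτ))
          (deriv_derivWeierstrassP_right_ne_zero hω hτ h₃₂ hr hl (by linarith))
        have gne : ∀ z ∈ halfContour ω₁ τ, z ≠ τ * I → z ≠ ω₁ + τ * I → g z ≠ 0 := by
          rintro _ ⟨t, ht, rfl⟩ n0 n1
          refine hg0 _ ⟨t, ⟨lt_of_le_of_ne ht.1 ?_, lt_of_le_of_ne ht.2 ?_⟩, rfl⟩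
          · rintro rfl
            simp at n0
          · rintro rfl
            simp [add_comm] at n1
        -- Both lists begin at `i τ` and end at `ω₁ + i τ`, so the first and last comparisons are
        -- equalities; the remaining ones follow from interior interlacing and the position of the
        -- ends.
        refine ⟨j + 1 + 2, j + 2, _, _,
          (listsZeros_comp_weierstrassP hω hτ h₃₂ hr hl hT hx hsub subset_rfl).mul_of_simple_ends
            hga hA hB hAB gA gB gne,
          (listsZeros_comp_weierstrassP hω hτ h₃₂ hr hl hT hy hsub subset_rfl).mul_of_simple_ends
            hga hA hB hAB gA gB gne, Or.inr (by omega), ?_, ?_⟩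
        · have hle1 : ∀ v ∈ Set.Ioo e₃ e₂,
              (τ * I + T v * ω₁ : ℂ).re ≤ (ω₁ + τ * I : ℂ).re := by
            intro v hv
            have := mul_lt_mul_of_pos_right (hT v hv).1.2 hω
            simp
            linarith
          intro i hi
          rcases i with _ | i
          · rw [addEnds_zero, addEnds_zero]
          · rw [addEnds_succ _ _ _ (by omega : i < j + 1)]
            rcases (show i ≤ j by omega).eq_or_lt with rfl | hij
            · rw [addEnds_last]
              exact hle1 _ (hx.mem i (by omega))
            · rw [addEnds_succ _ _ _ hij]
              exact (hx1 i hij).le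
        · have hle0 : ∀ v ∈ Set.Ioo e₃ e₂, (τ * I : ℂ).re ≤ (τ * I + T v * ω₁ : ℂ).re := by
            intro v hv
            have := mul_pos (hT v hv).1.1 hω
            simp
            linarith
          intro i hi
          rcases (show i ≤ j + 1 by omega).eq_or_lt with rfl | hij
          · rw [addEnds_last, addEnds_last]
          · rw [addEnds_succ _ _ _ hij]
            rcases i with _ | i
            · rw [addEnds_zero]
              exact hle0 _ (hx.mem 0 (by omega))
            · rw [addEnds_succ _ _ _ (by omega : i < j)]
              exact (hx2 i (by omega)).le
  · intro n hn
    obtain ⟨m, rfl⟩ : ∃ m, n = m + 1 := ⟨n - 1, by omega⟩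
    rw [Nat.add_sub_cancel]
    obtain ⟨x, hx⟩ := exists_hasSortedZeros_orthoPoly h₃₂ hw (m + 1)
    obtain ⟨y, hy⟩ := exists_hasSortedZeros_orthoPoly h₃₂ hw' m
    have hxy := interlacing_orthoPoly_modifiedWeight h₃₂ h21 hw hx hy
    have key : ∀ {P : ℝ[X]} {N : ℕ} {x : ℕ → ℝ}, HasSortedZeros P e₃ e₂ N x →
        ListsZeros (realPolyFun P) (realSegment e₃ e₂) N (fun i => (x i : ℂ)) := by
      intro P N x hP
      -- The lifting lemma applies with the identity in place of `℘`.
      exact listsZeros_comp hP (f := fun z => z) (fun z _ => analyticAt_id)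
        (fun z _ z' _ h => h)
        (fun i hi => ⟨x i, Set.Ioo_subset_Icc_self (hP.mem i hi), rfl⟩) (fun _ _ => rfl)
        (fun _ _ => by simp)
    exact ⟨m + 1, m, _, _, key hx, key hy, Or.inr rfl, fun i hi => by simpa using (hxy i hi).1,
      fun i hi => by simpa using (hxy i (by omega)).2⟩
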